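/- **Theorem 1 (Thresholds are not privately learnable).** Logarithms are to base 2, and $\log^* x$ is the number of times $\log$ must be applied to $x$ before the result is at most $1$. For $X\subseteq\mathbb{R}$, the class of thresholds over $X$ consists of the functions $h_t:X\to\{\pm1\}$, $t\in\mathbb{R}$, with $h_t(x)=+1$ if and only if $x\ge t$. A randomized learning algorithm $A$ with sample complexity $m$ over $X$ maps each sample $S\in(X\times\{\pm1\})^m$ to a probability distribution $A(S)$ over the set $\{\pm1\}^X$ of all functions $X\to\{\pm1\}$ (so $A$ may be improper). It is $(\epsilon,\delta)$-differentially private if for all samples $S,S'$ that disagree on a single example and every event $E$, $\Pr[A(S)\in E]\le e^{\epsilon}\Pr[A(S')\in E]+\delta$ (and vice versa). It is an $(\alpha,\beta)$-accurate learner for a class $H\subseteq\{\pm1\}^X$ if for every probability distribution $D$ over $X\times\{\pm1\}$ that is realizable by $H$ (that is, $L_D(h)=0$ for some $h\in H$, where $L_D(h)=\Pr_{(x,y)\sim D}[h(x)\ne y]$), $$\Pr_{S\sim D^m,\ h\sim A(S)}\bigl[L_D(h)>\alpha\bigr]\le\beta .$$ There are absolute constants $c_0,c>0$ such that the following hold.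 1. Let $X\subseteq\mathbb{R}$ be finite with $|X|=n$, and let $A$ be a $(\frac1{16},\frac1{16})$-accurate learner for the class of thresholds over $X$ with sample complexity $m$ that is $(0.1,\delta)$-differentially private for some $\delta$ with $\delta\, m^2\log m\le c_0$ (for $m\geq 2$: $\delta\le \frac{c_0}{m^2\log m}$; for $m \le 1$ the left-hand side is read as $0$, so that nothing is required of $\delta$). Then $m\ge c\,\log^* n$. 2. Let $X\subseteq\mathbb{R}$ be infinite. Then for no $m$ is there a $(\frac1{16},\frac1{16})$-accurate learner for the class of thresholds over $X$ with sample complexity $m$ that is $(0.1,\delta)$-differentially private for some $\delta$ with $\delta\,m^2\log m\le c_0$. In particular, the class of thresholds over $X$ is not privately learnable: there are no algorithms $A_m$ ($m\in\mathbb{N}$, with sample complexity $m$) that are $(\epsilon(m),\delta(m))$-differentially private with $\epsilon(m)\le o(1)$ and $\delta(m)\le m^{-\omega(1)}$ and such that for all $\alpha,\beta>0$ the algorithm $A_m$ is an $(\alpha,\beta)$-accurate learner for the class for all sufficiently large $m$. -/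

import Mathlib

namespace PrivateLearning

open MeasureTheory Filter

noncomputable section

/-- The labels `{±1}`: `true` stands for `+1` and `false` for `-1`. -/
abbrev Label : Type := Bool

/-- A hypothesis over the domain `X` is an arbitrary function `X → {±1}`. -/
abbrev Hypothesis (X : Set ℝ) : Type := X → Label

/-- A sample of length `m` over the domain `X`. -/
abbrev Sample (X : Set ℝ) (m : ℕ) : Type := Fin m → X × Label

/-- The class of thresholds over `X`: the restrictions to `X` of the functions `ℝ → {±1}`
that are `+1` exactly on a half-line `[t, ∞)`. -/
def thresholds (X : Set ℝ) : Set (Hypothesis X) :=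
  {h | ∃ t : ℝ, ∀ x : X, h x = true ↔ t ≤ (x : ℝ)}

/-- The loss of `h` with respect to a distribution `D` over `X × {±1}` (Borel sets on `X`):
the probability of `h x ≠ y` for `(x, y) ∼ D`. -/
def loss {X : Set ℝ} (D : Measure (X × Label)) (h : Hypothesis X) : ℝ :=
  D.real {z | h z.1 ≠ z.2}

/-- `D` is realizable by the class `H`. -/
def Realizable {X : Set ℝ} (H : Set (Hypothesis X)) (D : Measure (X × Label)) : Prop :=
  ∃ h ∈ H, loss D h = 0

/-- A randomized (possibly improper) learning algorithm with input samples of length `m`: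
each sample `S` is mapped to a probability distribution `out S` over all hypotheses.
The events of that distribution form some σ-algebra on the set of hypotheses; all that is asked
of it is that the events `h x = 1` belong to it.  (If `X` is countable, the σ-algebra
generated by these events suffices; for uncountable `X` a larger one, such as the one of all sets
for algorithms with countably many possible outputs, is needed for the loss to be measurable.) -/
structure LearningAlgorithm (X : Set ℝ) (m : ℕ) where
  /-- the events -/
  events : MeasurableSpace (Hypothesis X)
  /-- `h x` is a random variable -/
  measurable_eval : ∀ x : X, Measurable[events] fun h : Hypothesis X => h x
  /-- the output distribution -/
  out : Sample X m → @Measure (Hypothesis X) events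
  /-- the output distribution is a probability distribution -/
  isProbabilityMeasure_out : ∀ S, IsProbabilityMeasure (out S)

/-- Two measures are `(ε, δ)`-indistinguishable. -/
def Indistinguishable {Ω : Type*} [MeasurableSpace Ω] (ε δ : ℝ) (p q : Measure Ω) : Prop :=
  ∀ E : Set Ω, MeasurableSet E →
    p.real E ≤ Real.exp ε * q.real E + δ ∧ q.real E ≤ Real.exp ε * p.real E + δ

/-- Two samples disagree on a single example. -/
def Neighbors {X : Set ℝ} {m : ℕ} (S S' : Sample X m) : Prop :=
  ∃ i, S i ≠ S' i ∧ ∀ j, j ≠ i → S j = S' j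

/-- `A` is `(ε, δ)`-differentially private. -/
def LearningAlgorithm.DifferentiallyPrivate {X : Set ℝ} {m : ℕ} (A : LearningAlgorithm X m)
    (ε δ : ℝ) : Prop :=
  ∀ S S' : Sample X m, Neighbors S S' →
    @Indistinguishable (Hypothesis X) A.events ε δ (A.out S) (A.out S')

/-- `A` is an `(α, β)`-accurate learner for `H` (in the realizable case): for every distribution
`D` realizable by `H`, if `S` consists of `m` independent draws from `D` and `h ∼ A(S)`, then the
probability that the loss of `h` exceeds `α` is at most `β`. -/
def LearningAlgorithm.Accurate {X : Set ℝ} {m : ℕ} (A : LearningAlgorithm X m)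
    (α β : ℝ) (H : Set (Hypothesis X)) : Prop :=
  ∀ D : Measure (X × Label), IsProbabilityMeasure D → Realizable H D →
    ∫⁻ S, A.out S {h | α < loss D h} ∂(Measure.pi fun _ : Fin m => D) ≤ ENNReal.ofReal β

/-- `H` is privately learnable: it is PAC learnable by an algorithm (one for each sample size `m`)
that is `(ε(m), δ(m))`-differentially private with `ε(m) ≤ o(1)` and `δ(m) ≤ m ^ (-ω(1))`. -/
def PrivatelyLearnable {X : Set ℝ} (H : Set (Hypothesis X)) : Prop :=
  ∃ (A : ∀ m : ℕ, LearningAlgorithm X m) (ε δ : ℕ → ℝ),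
    (∀ m, (A m).DifferentiallyPrivate (ε m) (δ m)) ∧
    (∀ η : ℝ, 0 < η → ∀ᶠ m in atTop, ε m ≤ η) ∧
    (∀ k : ℕ, ∀ᶠ m : ℕ in atTop, δ m ≤ 1 / (m : ℝ) ^ k) ∧
    ∀ α β : ℝ, 0 < α → 0 < β → ∃ m₀ : ℕ, ∀ m, m₀ ≤ m → (A m).Accurate α β H

/-- `log* x`: the number of times the (binary) logarithm must be applied to `x` before the result
is at most `1`. -/
def logStar (x : ℝ) : ℕ := sInf {k : ℕ | (Real.logb 2)^[k] x ≤ 1}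

theorem exists_iterate_logb_le_one (x : ℝ) : ∃ k : ℕ, (Real.logb 2)^[k] x ≤ 1 := by
  have key : ∀ (N : ℕ) (x : ℝ), x ≤ N + 1 → ∃ k : ℕ, (Real.logb 2)^[k] x ≤ 1 := by
    intro N
    induction N with
    | zero => intro x hx; exact ⟨0, by simpa using hx⟩
    | succ N ih =>
      intro x hx
      by_cases h1 : x ≤ 1
      · exact ⟨0, by simpa using h1⟩
      have hlog : Real.logb 2 x ≤ N + 1 := by
        have hpos : 0 < x := by linarith [not_le.mp h1]
        rw [Real.logb_le_iff_le_rpow (by norm_num) hpos]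
        have hb : (1 : ℝ) + ((N + 1 : ℕ) : ℝ) * 1 ≤ (1 + 1) ^ (N + 1) :=
          one_add_mul_le_pow (by norm_num) (N + 1)
        have he : (2 : ℝ) ^ ((N : ℝ) + 1) = 2 ^ (N + 1) := by
          rw [← Real.rpow_natCast]; push_cast; rfl
        rw [he]
        norm_num at hb
        push_cast at hx
        linarith
      obtain ⟨k, hk⟩ := ih _ hlog
      exact ⟨k + 1, by simpa [Function.iterate_succ_apply] using hk⟩
  obtain ⟨N, hN⟩ := exists_nat_ge x
  exact key N x (by linarith)

theorem logStar_of_le_one {x : ℝ} (hx : x ≤ 1) : logStar x = 0 := by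
  unfold logStar
  exact Nat.sInf_eq_zero.mpr (Or.inl (by simpa using hx))

theorem logStar_of_one_lt {x : ℝ} (hx : 1 < x) : logStar x = 1 + logStar (Real.logb 2 x) := by
  have hne : {k : ℕ | (Real.logb 2)^[k] x ≤ 1}.Nonempty := exists_iterate_logb_le_one x
  have h0 : 1 ≤ logStar x := by
    by_contra h
    have hz : logStar x = 0 := by omega
    have := Nat.sInf_mem hne
    rw [show sInf {k : ℕ | (Real.logb 2)^[k] x ≤ 1} = 0 from hz] at this
    exact absurd (show x ≤ 1 by simpa using this) (not_le.mpr hx)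
  have h := Nat.sInf_add (p := fun k => (Real.logb 2)^[k] x ≤ 1) (n := 1) h0
  unfold logStar
  rw [← h, add_comm]
  rfl

end

end PrivateLearning

open PrivateLearning

/-!
A private learner of thresholds yields many pairwise indistinguishable distributions which a binary
search nevertheless tells apart; this bounds the size of the domain.

Let `A` be the learner and `A.prob S x` the probability that its output on the sample `S` takes the
value `+1` at `x`. By Ramsey's theorem for `(m + 1)`-sets, applied to the colouring that records the
rounded values `A.prob S x` for all ways of splitting an `(m + 1)`-set into a sample and a query
point, a large part of the domain is homogeneous (`exists_homogeneous_of_sample`): there `A.prob S x`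
depends, up to a small error, only on the order type and the labels of `S` and on the gap of `S` that
contains `x`. The homogeneous part can be as large as needed unless the size of the domain is at most
a tower of height `O(m)` (`ramseyBound_le_tower`).

Accuracy on a uniform distribution whose labels change in the middle of the domain gives a sample
with distinct points for which `A.prob S x` is small for some `x` on the left and large for some `x`
on the right. As it takes at most `m + 1` values up to a small error, it jumps by `Ω(1 / m)` at some
point of the sample (`exists_jump`). By homogeneity this point can be moved over `2 ^ T` positions
without changing the size of the jump. The resulting samples are neighbours, so the output
distributions are pairwise `(0.1, δ)`-indistinguishable, and the value of the hypothesis at a query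
point tells, with a margin `χ = Ω(1 / m)`, on which side of it the moved point lies.

Now draw `T` hypotheses independently and locate the moved point by binary search, comparing empirical
means. By Hoeffding's inequality each of the `T` comparisons fails with probability at most
`exp (-2 χ² T)`, so that `T` of order `m² log m` suffices for the search to succeed with probability
`2 / 3`. The `T`-fold products are `(0.1 T, T δ)`-indistinguishable (`Indistinguishable.pi`), and
`T δ ≤ 1 / 3` by the hypothesis on `δ`. Hence under one fixed product each of the `2 ^ T` disjoint
success events has probability at least `exp (-0.1 T) / 3`
(`two_pow_le_of_indistinguishable`), which contradicts `2 ^ T > 3 exp (0.1 T)`.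

For `m ≤ 1` nothing is assumed about `δ`, but then accuracy alone fails on two points
(`LearningAlgorithm.Accurate.card_le_one`).
-/

namespace PrivateLearning

open MeasureTheory ProbabilityTheory

/-! ### Ramsey's theorem with tower bounds -/

/-- A set is end-homogeneous for a colouring `c` of finite sets if the colour of a finite subset is
determined by the subset without its maximum. Every colouring with at most `q` colours has an
end-homogeneous set of size `t` inside any set with `q ^ 4 ^ t` elements. -/
theorem exists_endHomogeneous {α : Type*} [LinearOrder α] {κ : Type*} [Fintype κ] {q : ℕ}
    (hq : 2 ≤ q) (hκ : Fintype.card κ ≤ q) (t : ℕ) {V : Finset α} (hV : q ^ 4 ^ t ≤ V.card)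
    (c : Finset α → κ) :
    ∃ W ⊆ V, W.card = t ∧ ∃ c' : Finset α → κ,
      ∀ s ⊆ W, ∀ x ∈ W, (∀ y ∈ s, y < x) → c (insert x s) = c' s := by
  induction t generalizing κ q V with
  | zero => exact ⟨∅, by simp, rfl, c, by simp⟩
  | succ t ih =>
    classical
    have hκ0 : (Finset.univ : Finset κ).Nonempty := ⟨c ∅, Finset.mem_univ _⟩
    -- First make the colour of singletons constant.
    obtain ⟨k, -, hk⟩ := Finset.exists_le_card_fiber_of_mul_le_card_of_maps_to
      (s := V) (t := (Finset.univ : Finset κ)) (f := fun x => c {x}) (n := q ^ (4 ^ (t + 1) - 1))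
      (fun _ _ => Finset.mem_univ _) hκ0 <| by
        refine le_trans ?_ hV
        calc _ ≤ q * q ^ (4 ^ (t + 1) - 1) := Nat.mul_le_mul_right _ hκ
          _ = q ^ 4 ^ (t + 1) := by
            rw [← pow_succ']
            congr 1
            have : 0 < 4 ^ (t + 1) := by positivity
            omega
    set V₀ := V.filter (fun x => c {x} = k) with hV₀
    have hV₀ne : V₀.Nonempty := by
      rw [← Finset.card_pos]
      exact lt_of_lt_of_le (by positivity) hk
    set v := V₀.min' hV₀ne with hv
    have hvV₀ : v ∈ V₀ := Finset.min'_mem _ _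
    have hcard : (q ^ 2) ^ 4 ^ t ≤ (V₀.erase v).card := by
      rw [Finset.card_erase_of_mem hvV₀]
      have h1 : (q ^ 2) ^ 4 ^ t * 2 ≤ q ^ (4 ^ (t + 1) - 1) := by
        rw [← pow_mul]
        calc q ^ (2 * 4 ^ t) * 2 ≤ q ^ (2 * 4 ^ t) * q := Nat.mul_le_mul_left _ hq
          _ = q ^ (2 * 4 ^ t + 1) := (pow_succ _ _).symm
          _ ≤ _ := Nat.pow_le_pow_right (by omega) (by
            have : 0 < 4 ^ t := by positivity
            rw [pow_succ]
            omega)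
      have h2 : 0 < (q ^ 2) ^ 4 ^ t := by positivity
      omega
    -- Then colour a set both by its own colour and by the colour after adding `v`.
    obtain ⟨W, hWV, hWc, d, hd⟩ := ih (κ := κ × κ) (q := q ^ 2) (by nlinarith)
      (by rw [Fintype.card_prod, sq]; exact Nat.mul_le_mul hκ hκ) hcard
      (fun s => (c s, c (insert v s)))
    have hvW : v ∉ W := fun h => (Finset.mem_erase.1 (hWV h)).1 rfl
    have hWV₀ : W ⊆ V₀ := hWV.trans (Finset.erase_subset _ _)
    have hlt : ∀ x ∈ W, v < x := fun x hx =>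
      lt_of_le_of_ne (Finset.min'_le _ _ (hWV₀ hx)) fun h => hvW (h ▸ hx)
    refine ⟨insert v W, ?_, by rw [Finset.card_insert_of_notMem hvW, hWc],
      fun s => if s = ∅ then k else if v ∈ s then (d (s.erase v)).2 else (d s).1, ?_⟩
    · exact Finset.insert_subset (Finset.filter_subset _ _ hvV₀)
        (hWV₀.trans (Finset.filter_subset _ _))
    · intro s hs x hx hsx
      by_cases hs0 : s = ∅
      · have : x ∈ V₀ := by
          rcases Finset.mem_insert.1 hx with rfl | h
          · exact hvV₀
          · exact hWV₀ h
        simpa [hs0] using (Finset.mem_filter.1 this).2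
      · have hxW : x ∈ W := by
          rcases Finset.mem_insert.1 hx with rfl | h
          · obtain ⟨y, hy⟩ := Finset.nonempty_iff_ne_empty.2 hs0
            rcases Finset.mem_insert.1 (hs hy) with h | h
            · exact absurd (hsx y hy) (by simp [h])
            · exact absurd (hsx y hy) (not_lt.2 (hlt y h).le)
          · exact h
        by_cases hvs : v ∈ s
        · have h := hd (s.erase v)
            (fun y hy => (Finset.mem_insert.1 (hs (Finset.mem_of_mem_erase hy))).resolve_left
              (Finset.ne_of_mem_erase hy)) x hxW
            (fun y hy => hsx y (Finset.mem_of_mem_erase hy))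
          have h2 := congrArg Prod.snd h
          simp only at h2
          rw [Finset.insert_comm, Finset.insert_erase hvs] at h2
          simp [hs0, hvs, h2]
        · have h := hd s (fun y hy => (Finset.mem_insert.1 (hs hy)).resolve_left
            (fun e => hvs (e ▸ hy))) x hxW hsx
          have h2 := congrArg Prod.fst h
          simp only at h2
          simp [hs0, hvs, h2]

/-- A bound for the Ramsey number of `r`-sets with `q` colours and homogeneous sets of size `N`. -/
def ramseyBound (q N : ℕ) : ℕ → ℕ
  | 0 => N
  | r + 1 => q ^ 4 ^ ramseyBound q N r

/-- Ramsey's theorem for `r`-sets. -/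
theorem exists_homogeneous {α : Type*} [LinearOrder α] {κ : Type*} [Fintype κ] {q N : ℕ}
    (hq : 2 ≤ q) (hκ : Fintype.card κ ≤ q) (r : ℕ) {V : Finset α}
    (hV : ramseyBound q N r ≤ V.card) (c : Finset α → κ) :
    ∃ W ⊆ V, W.card = N ∧ ∃ k, ∀ s ⊆ W, s.card = r → c s = k := by
  induction r generalizing V c with
  | zero =>
    obtain ⟨W, hW, hc⟩ := Finset.exists_subset_card_eq hV
    refine ⟨W, hW, hc, c ∅, fun s _ h => ?_⟩
    rw [Finset.card_eq_zero.1 h]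
  | succ r ih =>
    obtain ⟨W, hWV, hWc, c', hc'⟩ := exists_endHomogeneous hq hκ _ hV c
    obtain ⟨U, hUW, hUc, k, hk⟩ := ih hWc.ge c'
    refine ⟨U, hUW.trans hWV, hUc, k, fun s hs hsc => ?_⟩
    have hne : s.Nonempty := Finset.card_pos.1 (by omega)
    have hm := s.max'_mem hne
    rw [← hk (s.erase (s.max' hne)) ((Finset.erase_subset _ _).trans hs)
      (by rw [Finset.card_erase_of_mem hm]; omega),
      ← hc' _ ((Finset.erase_subset _ _).trans (hs.trans hUW)) _ (hUW (hs hm))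
        (fun y hy => s.lt_max'_of_mem_erase_max' hne hy), Finset.insert_erase hm]

/-! ### Towers of exponentials and the iterated logarithm -/

/-- The tower function: `tower k` is a tower of `k` twos. -/
def tower : ℕ → ℕ
  | 0 => 1
  | k + 1 => 2 ^ tower k

theorem tower_le_succ (k : ℕ) : tower k ≤ tower (k + 1) := Nat.lt_two_pow_self.le

theorem tower_mono : Monotone tower := monotone_nat_of_le_succ tower_le_succ

theorem lt_tower (k : ℕ) : k < tower k := by
  induction k with
  | zero => exact Nat.one_pos
  | succ k ih => exact lt_of_le_of_lt ih Nat.lt_two_pow_self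

theorem logStar_le_of_le_tower {k : ℕ} {x : ℝ} (hx : x ≤ tower k) : logStar x ≤ k := by
  induction k generalizing x with
  | zero => exact (logStar_of_le_one (by simpa [tower] using hx)).le
  | succ k ih =>
    rcases le_or_gt x 1 with h1 | h1
    · rw [logStar_of_le_one h1]; exact Nat.zero_le _
    · have : Real.logb 2 x ≤ tower k := by
        rw [Real.logb_le_iff_le_rpow (by norm_num) (by linarith), Real.rpow_natCast]
        simpa [tower] using hx
      rw [logStar_of_one_lt h1, add_comm]
      exact Nat.succ_le_succ (ih this)

theorem three_mul_le_two_pow {x : ℕ} (hx : 4 ≤ x) : 3 * x ≤ 2 ^ x := by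
  induction x, hx using Nat.le_induction with
  | base => norm_num
  | succ x hx ih => rw [pow_succ]; omega

/-- Each of the steps in the recursion for `ramseyBound` costs at most three exponentials. -/
theorem ramseyBound_le_tower {q N k : ℕ} (hk : 2 ≤ k) (hq : q ≤ tower k) (hN : N ≤ tower k)
    (r : ℕ) : ramseyBound q N r ≤ tower (k + 3 * r) := by
  induction r with
  | zero => exact hN
  | succ r ih =>
    set x := tower (k + 3 * r) with hx
    have hx4 : 4 ≤ x := le_trans (by decide) (tower_mono (show 2 ≤ k + 3 * r by omega))
    have hqx : q ≤ 2 ^ x := (hq.trans (tower_mono (by omega))).trans Nat.lt_two_pow_self.le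
    calc ramseyBound q N (r + 1) ≤ (2 ^ x) ^ 4 ^ x :=
          (Nat.pow_le_pow_left hqx _).trans
            (Nat.pow_le_pow_right (by positivity) (Nat.pow_le_pow_right (by norm_num) ih))
      _ = 2 ^ (x * 2 ^ (2 * x)) := by rw [← pow_mul, pow_mul 2 2 x]; norm_num
      _ ≤ 2 ^ 2 ^ (3 * x) := by
          refine Nat.pow_le_pow_right (by norm_num) ?_
          rw [show 3 * x = x + 2 * x by ring, pow_add]
          exact Nat.mul_le_mul_right _ Nat.lt_two_pow_self.le
      _ ≤ 2 ^ 2 ^ 2 ^ x := Nat.pow_le_pow_right (by norm_num)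
          (Nat.pow_le_pow_right (by norm_num) (three_mul_le_two_pow hx4))
      _ = tower (k + 3 * (r + 1)) := by
          rw [show k + 3 * (r + 1) = k + 3 * r + 1 + 1 + 1 by ring]; rfl

/-! ### Composition of indistinguishable measures -/

/-- Events may be replaced by `[0, 1]`-valued functions in the definition of indistinguishability;
one direction. -/
theorem Indistinguishable.integral_le {Ω : Type*} [MeasurableSpace Ω] {ε δ : ℝ} {p q : Measure Ω}
    [IsProbabilityMeasure p] [IsProbabilityMeasure q]
    (h : Indistinguishable ε δ p q) {f : Ω → ℝ} (hf : Measurable f) (h0 : ∀ ω, 0 ≤ f ω)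
    (h1 : ∀ ω, f ω ≤ 1) : ∫ ω, f ω ∂p ≤ Real.exp ε * ∫ ω, f ω ∂q + δ := by
  have hint : ∀ (μ : Measure Ω) [IsProbabilityMeasure μ], Integrable f μ := fun μ _ =>
    Integrable.of_mem_Icc 0 1 hf.aemeasurable (Filter.Eventually.of_forall fun ω => ⟨h0 ω, h1 ω⟩)
  have key : ∀ (μ : Measure Ω) [IsProbabilityMeasure μ],
      ∫ ω, f ω ∂μ = ∫ t in (0 : ℝ)..1, μ.real {ω | t ≤ f ω} := by
    intro μ _
    rw [(hint μ).integral_eq_integral_meas_le (Filter.Eventually.of_forall h0)]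
    rw [intervalIntegral.integral_of_le zero_le_one]
    refine setIntegral_eq_of_subset_of_forall_sdiff_eq_zero measurableSet_Ioi
      (Set.Ioc_subset_Ioi_self (a := (1 : ℝ)) (b := 0)) fun t ht => ?_
    have : {ω | t ≤ f ω} = ∅ := by
      ext ω
      simp only [Set.mem_sdiff, Set.mem_Ioi, Set.mem_Ioc, not_and, not_le] at ht
      simpa using lt_of_le_of_lt (h1 ω) (ht.2 ht.1)
    simp [this]
  have hii : ∀ (μ : Measure Ω) [IsProbabilityMeasure μ],
      IntervalIntegrable (fun t => μ.real {ω | t ≤ f ω}) volume 0 1 := by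
    intro μ _
    apply AntitoneOn.intervalIntegrable
    intro s _ t _ hst
    exact measureReal_mono fun ω (hω : t ≤ f ω) => hst.trans hω
  rw [key p, key q, ← intervalIntegral.integral_const_mul]
  calc _ ≤ ∫ t in (0 : ℝ)..1, (Real.exp ε * q.real {ω | t ≤ f ω} + δ) := by
        refine intervalIntegral.integral_mono_on zero_le_one (hii p)
          (((hii q).const_mul _).add (intervalIntegrable_const (c := δ))) fun t _ => ?_
        exact (h _ (measurableSet_le measurable_const hf)).1
    _ = _ := by
        rw [intervalIntegral.integral_add ((hii q).const_mul _) intervalIntegrable_const]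
        simp

/-- Basic composition, one direction. The truncation of `e ^ ε₂ * q₂ E + δ₂` at `1` keeps the two
additive errors from being multiplied by `e ^ ε₁` or `e ^ ε₂`. -/
theorem Indistinguishable.prod_le {Ω₁ Ω₂ : Type*} [MeasurableSpace Ω₁] [MeasurableSpace Ω₂]
    {ε₁ ε₂ δ₁ δ₂ : ℝ} {p₁ q₁ : Measure Ω₁} {p₂ q₂ : Measure Ω₂}
    [IsProbabilityMeasure p₁] [IsProbabilityMeasure q₁]
    [IsProbabilityMeasure p₂] [IsProbabilityMeasure q₂] (hδ : 0 ≤ δ₂)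
    (h₁ : Indistinguishable ε₁ δ₁ p₁ q₁) (h₂ : Indistinguishable ε₂ δ₂ p₂ q₂)
    {E : Set (Ω₁ × Ω₂)} (hE : MeasurableSet E) :
    (p₁.prod p₂).real E ≤ Real.exp (ε₁ + ε₂) * (q₁.prod q₂).real E + (δ₁ + δ₂) := by
  have hfub : ∀ (μ : Measure Ω₁) (ν : Measure Ω₂) [IsProbabilityMeasure μ]
      [IsProbabilityMeasure ν], (μ.prod ν).real E = ∫ x, ν.real (Prod.mk x ⁻¹' E) ∂μ := by
    intro μ ν _ _
    rw [measureReal_def, Measure.prod_apply hE, ← integral_toReal]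
    · rfl
    · exact (measurable_measure_prodMk_left hE).aemeasurable
    · exact Filter.Eventually.of_forall fun x => measure_lt_top _ _
  have hmeas : ∀ (ν : Measure Ω₂) [IsProbabilityMeasure ν],
      Measurable fun x => ν.real (Prod.mk x ⁻¹' E) := fun ν _ =>
    (measurable_measure_prodMk_left hE).ennreal_toReal
  have hint : ∀ {f : Ω₁ → ℝ} (μ : Measure Ω₁) [IsProbabilityMeasure μ], Measurable f →
      (∀ x, f x ∈ Set.Icc (0 : ℝ) 1) → Integrable f μ := fun μ _ hf h =>
    Integrable.of_mem_Icc 0 1 hf.aemeasurable (Filter.Eventually.of_forall h)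
  set f : Ω₁ → ℝ := fun x => min 1 (Real.exp ε₂ * q₂.real (Prod.mk x ⁻¹' E)) with hf
  have hfm : Measurable f := measurable_const.min ((hmeas q₂).const_mul _)
  have hf01 : ∀ x, f x ∈ Set.Icc (0 : ℝ) 1 := fun x =>
    ⟨le_min zero_le_one (by positivity), min_le_left _ _⟩
  rw [hfub, hfub]
  have hp01 : ∀ (ν : Measure Ω₂) [IsProbabilityMeasure ν] (x : Ω₁),
      ν.real (Prod.mk x ⁻¹' E) ∈ Set.Icc (0 : ℝ) 1 := fun _ _ _ =>
    ⟨measureReal_nonneg, measureReal_le_one⟩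
  calc ∫ x, p₂.real (Prod.mk x ⁻¹' E) ∂p₁ ≤ ∫ x, (f x + δ₂) ∂p₁ := by
        refine integral_mono (hint p₁ (hmeas p₂) (hp01 p₂))
          ((hint _ hfm hf01).add (integrable_const δ₂)) fun x => ?_
        have h2 := (h₂ _ (measurable_prodMk_left (x := x) hE)).1
        have h3 := (hp01 p₂ x).2
        simp only [hf]
        rcases min_cases 1 (Real.exp ε₂ * q₂.real (Prod.mk x ⁻¹' E)) with h | h <;>
          rw [h.1] <;> linarith
    _ = ∫ x, f x ∂p₁ + δ₂ := by
        rw [integral_add (hint _ hfm hf01) (integrable_const _)]; simp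
    _ ≤ (Real.exp ε₁ * ∫ x, f x ∂q₁ + δ₁) + δ₂ := by
        gcongr
        exact h₁.integral_le hfm (fun x => (hf01 x).1) (fun x => (hf01 x).2)
    _ ≤ (Real.exp ε₁ * ∫ x, Real.exp ε₂ * q₂.real (Prod.mk x ⁻¹' E) ∂q₁ + δ₁) + δ₂ := by
        refine add_le_add_left (add_le_add_left (mul_le_mul_of_nonneg_left (integral_mono
          (hint q₁ hfm hf01) ((hint q₁ (hmeas q₂) (hp01 q₂)).const_mul _) fun x => ?_)
          (Real.exp_pos _).le) _) _
        exact min_le_right _ _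
    _ = _ := by rw [integral_const_mul, Real.exp_add]; ring

theorem Indistinguishable.symm {Ω : Type*} [MeasurableSpace Ω] {ε δ : ℝ} {p q : Measure Ω}
    (h : Indistinguishable ε δ p q) : Indistinguishable ε δ q p := fun E hE => (h E hE).symm

theorem Indistinguishable.prod {Ω₁ Ω₂ : Type*} [MeasurableSpace Ω₁] [MeasurableSpace Ω₂]
    {ε₁ ε₂ δ₁ δ₂ : ℝ} {p₁ q₁ : Measure Ω₁} {p₂ q₂ : Measure Ω₂}
    [IsProbabilityMeasure p₁] [IsProbabilityMeasure q₁]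
    [IsProbabilityMeasure p₂] [IsProbabilityMeasure q₂] (hδ : 0 ≤ δ₂)
    (h₁ : Indistinguishable ε₁ δ₁ p₁ q₁) (h₂ : Indistinguishable ε₂ δ₂ p₂ q₂) :
    Indistinguishable (ε₁ + ε₂) (δ₁ + δ₂) (p₁.prod p₂) (q₁.prod q₂) :=
  fun _ hE => ⟨h₁.prod_le hδ h₂ hE, h₁.symm.prod_le hδ h₂.symm hE⟩

theorem Indistinguishable.delta_nonneg {Ω : Type*} [MeasurableSpace Ω] {ε δ : ℝ}
    {p q : Measure Ω} (h : Indistinguishable ε δ p q) : 0 ≤ δ := by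
  simpa using (h ∅ MeasurableSet.empty).1

/-- Privacy degrades linearly for `T` independent repetitions. -/
theorem Indistinguishable.pi {Ω : Type*} [MeasurableSpace Ω] {ε δ : ℝ} {p q : Measure Ω}
    [IsProbabilityMeasure p] [IsProbabilityMeasure q] (h : Indistinguishable ε δ p q) (T : ℕ) :
    Indistinguishable (T * ε) (T * δ) (Measure.pi fun _ : Fin T => p)
      (Measure.pi fun _ : Fin T => q) := by
  induction T with
  | zero =>
    intro E _
    rw [Measure.pi_of_empty, Measure.pi_of_empty]
    simp
  | succ T ih =>
    have hp := measurePreserving_piFinSuccAbove (fun _ : Fin (T + 1) => p) 0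
    have hq := measurePreserving_piFinSuccAbove (fun _ : Fin (T + 1) => q) 0
    have hprod := h.prod (mul_nonneg (Nat.cast_nonneg T) h.delta_nonneg) ih
    intro E hE
    set e := MeasurableEquiv.piFinSuccAbove (fun _ : Fin (T + 1) => Ω) 0
    have hE' : MeasurableSet (e.symm ⁻¹' E) := e.symm.measurable hE
    have key := hprod _ hE'
    have hpre : e ⁻¹' (e.symm ⁻¹' E) = E := by ext; simp
    have hpE := hp.measureReal_preimage hE'.nullMeasurableSet
    have hqE := hq.measureReal_preimage hE'.nullMeasurableSet
    rw [hpre] at hpE hqE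
    rw [hpE, hqE]
    push_cast
    rw [show ((T : ℝ) + 1) * ε = ε + T * ε by ring, show ((T : ℝ) + 1) * δ = δ + T * δ by ring]
    exact key

/-! ### Binary search among indistinguishable measures -/

/-- The number of coordinates of `ω` in the set `E`. -/
noncomputable def hits {Ω : Type*} {T : ℕ} (E : Set Ω) (ω : Fin T → Ω) : ℝ :=
  ∑ t, E.indicator (fun _ => (1 : ℝ)) (ω t)

theorem measurable_hits {Ω : Type*} [MeasurableSpace Ω] {T : ℕ} {E : Set Ω}
    (hE : MeasurableSet E) : Measurable (hits E : (Fin T → Ω) → ℝ) :=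
  Finset.measurable_sum _ fun t _ =>
    (measurable_const.indicator hE).comp (measurable_pi_apply t)

theorem measureReal_sum_sub_integral_ge_le {Ω : Type*} [MeasurableSpace Ω] {T : ℕ}
    (p : Measure Ω) [IsProbabilityMeasure p] {f : Ω → ℝ} (hf : Measurable f) {a : ℝ}
    (hf01 : ∀ ω, f ω ∈ Set.Icc a (a + 1)) {χ : ℝ} (hχ : 0 ≤ χ) :
    (Measure.pi fun _ : Fin T => p).real {ω | T * χ ≤ ∑ t, (f (ω t) - ∫ x, f x ∂p)} ≤
      Real.exp (-2 * χ ^ 2 * T) := by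
  have hind : iIndepFun (fun (t : Fin T) (ω : Fin T → Ω) => f (ω t) - ∫ x, f x ∂p)
      (Measure.pi fun _ : Fin T => p) :=
    iIndepFun_pi (X := fun _ x => f x - ∫ x, f x ∂p)
      fun _ => (hf.sub_const _).aemeasurable
  have hsub : ∀ t ∈ (Finset.univ : Finset (Fin T)),
      HasSubgaussianMGF (fun ω : Fin T → Ω => f (ω t) - ∫ x, f x ∂p) ((‖(a + 1) - a‖₊ / 2) ^ 2)
        (Measure.pi fun _ : Fin T => p) := by
    intro t _
    have h := hasSubgaussianMGF_of_mem_Icc (μ := Measure.pi fun _ : Fin T => p)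
      (X := fun ω => f (ω t)) (a := a) (b := a + 1)
      (hf.comp (measurable_pi_apply t)).aemeasurable
      (Filter.Eventually.of_forall fun ω => hf01 _)
    have he : ∫ ω : Fin T → Ω, f (ω t) ∂(Measure.pi fun _ : Fin T => p) = ∫ x, f x ∂p :=
      integral_comp_eval (μ := fun _ : Fin T => p) hf.aestronglyMeasurable
    rwa [he] at h
  refine (HasSubgaussianMGF.measure_sum_ge_le_of_iIndepFun hind hsub
    (ε := T * χ) (by positivity)).trans (Real.exp_le_exp.2 ?_)
  rcases Nat.eq_zero_or_pos T with rfl | hT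
  · simp
  · have hT' : (0 : ℝ) < T := by exact_mod_cast hT
    simp only [add_sub_cancel_left, nnnorm_one, Finset.sum_const, Finset.card_univ,
      Fintype.card_fin, nsmul_eq_mul]
    push_cast
    apply le_of_eq
    field_simp

theorem measureReal_hits_gt_le {Ω : Type*} [MeasurableSpace Ω] {T : ℕ}
    (p : Measure Ω) [IsProbabilityMeasure p] {E : Set Ω} (hE : MeasurableSet E) {r χ : ℝ}
    (hχ : 0 ≤ χ) (h : p.real E ≤ r - χ) :
    (Measure.pi fun _ : Fin T => p).real {ω | T * r < hits E ω} ≤ Real.exp (-2 * χ ^ 2 * T) := by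
  have hi : ∫ x, E.indicator (fun _ => (1 : ℝ)) x ∂p = p.real E := integral_indicator_one hE
  refine le_trans (measureReal_mono ?_) (measureReal_sum_sub_integral_ge_le p
    (f := E.indicator fun _ => (1 : ℝ)) (measurable_const.indicator hE) (a := 0) ?_ hχ)
  · intro ω hω
    simp only [Set.mem_ofPred_eq, hi, Finset.sum_sub_distrib, Finset.sum_const, Finset.card_univ,
      Fintype.card_fin, nsmul_eq_mul] at hω ⊢
    have : (T : ℝ) * p.real E ≤ T * (r - χ) := by gcongr
    unfold hits at hω
    linarith
  · intro ω
    by_cases hω : ω ∈ E <;> simp [hω]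

theorem measureReal_hits_le_le {Ω : Type*} [MeasurableSpace Ω] {T : ℕ}
    (p : Measure Ω) [IsProbabilityMeasure p] {E : Set Ω} (hE : MeasurableSet E) {r χ : ℝ}
    (hχ : 0 ≤ χ) (h : r + χ ≤ p.real E) :
    (Measure.pi fun _ : Fin T => p).real {ω | hits E ω ≤ T * r} ≤ Real.exp (-2 * χ ^ 2 * T) := by
  have hi : ∫ x, -E.indicator (fun _ => (1 : ℝ)) x ∂p = -p.real E := by
    rw [integral_neg]
    congr 1
    exact integral_indicator_one hE
  refine le_trans (measureReal_mono ?_) (measureReal_sum_sub_integral_ge_le p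
    (f := fun x => -E.indicator (fun _ => (1 : ℝ)) x) (measurable_const.indicator hE).neg
    (a := -1) ?_ hχ)
  · intro ω hω
    simp only [Set.mem_ofPred_eq, hi, Finset.sum_sub_distrib, Finset.sum_const, Finset.card_univ,
      Fintype.card_fin, nsmul_eq_mul, Finset.sum_neg_distrib] at hω ⊢
    have : (T : ℝ) * (r + χ) ≤ T * p.real E := by gcongr
    unfold hits at hω
    linarith
  · intro ω
    by_cases hω : ω ∈ E <;> simp [hω]

/-- The midpoint compared with `j` at level `l` of a binary search in `[0, 2 ^ L)`, where
`l = L - 1` is the first comparison: the middle of the dyadic interval of length `2 ^ (l + 1)`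
around `j`. -/
def searchPoint (l j : ℕ) : ℕ := (2 * (j / 2 ^ (l + 1)) + 1) * 2 ^ l

theorem searchPoint_le {L l j : ℕ} (hl : l < L) (hj : j < 2 ^ L) : searchPoint l j ≤ 2 ^ L := by
  have h1 : j / 2 ^ (l + 1) < 2 ^ (L - (l + 1)) := by
    rw [Nat.div_lt_iff_lt_mul (by positivity), ← pow_add]
    rwa [show L - (l + 1) + (l + 1) = L by omega]
  calc searchPoint l j ≤ (2 * 2 ^ (L - (l + 1))) * 2 ^ l :=
        Nat.mul_le_mul_right _ (by omega)
    _ = 2 ^ L := by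
        rw [← pow_succ', ← pow_add]
        congr 1
        omega

/-- Two different elements are separated by a midpoint common to their binary searches. -/
theorem exists_searchPoint_separates {L j j' : ℕ} (hj : j < 2 ^ L) (hj' : j' < 2 ^ L)
    (hne : j < j') : ∃ l < L, searchPoint l j = searchPoint l j' ∧ j < searchPoint l j ∧
      searchPoint l j ≤ j' := by
  classical
  have hex : ∃ l, j / 2 ^ l = j' / 2 ^ l :=
    ⟨L, by rw [Nat.div_eq_of_lt hj, Nat.div_eq_of_lt hj']⟩
  have hspec := Nat.find_spec hex
  have hle : Nat.find hex ≤ L :=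
    Nat.find_min' hex (by rw [Nat.div_eq_of_lt hj, Nat.div_eq_of_lt hj'])
  obtain ⟨l, hl⟩ : ∃ l, Nat.find hex = l + 1 := by
    refine Nat.exists_eq_succ_of_ne_zero fun h => ?_
    rw [h] at hspec
    simp at hspec
    omega
  have hmin : j / 2 ^ l ≠ j' / 2 ^ l := Nat.find_min hex (by omega)
  rw [hl] at hspec hle
  have hlt : j / 2 ^ l < j' / 2 ^ l := lt_of_le_of_ne (Nat.div_le_div_right hne.le) hmin
  have e : ∀ i, i / 2 ^ (l + 1) = i / 2 ^ l / 2 := fun i => by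
    rw [pow_succ, Nat.div_div_eq_div_mul]
  refine ⟨l, hle, by unfold searchPoint; rw [hspec], ?_, ?_⟩
  · unfold searchPoint
    rw [← Nat.div_lt_iff_lt_mul (by positivity), e]
    rw [e, e] at hspec
    omega
  · unfold searchPoint
    rw [← Nat.le_div_iff_mul_le (by positivity), e]
    rw [e, e] at hspec
    omega

/-- If the events `E i` distinguish `P j` for `j < i` from `P j` for `i ≤ j` with a margin `χ`, then
binary search on `T` independent draws from an unknown `P j` finds `j` with probability at least
`2 / 3`. This gives disjoint events, one for each of the `2 ^ L` measures, and by
indistinguishability all of them have probability at least `e ^ (-ε T) / 3` under `P 0`. -/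
theorem two_pow_le_of_indistinguishable {Ω : Type*} [MeasurableSpace Ω] {ε δ r χ : ℝ} {L T : ℕ}
    (P : ℕ → Measure Ω) (hP : ∀ j < 2 ^ L, IsProbabilityMeasure (P j))
    (hind : ∀ j < 2 ^ L, Indistinguishable ε δ (P j) (P 0)) (E : ℕ → Set Ω)
    (hE : ∀ i ≤ 2 ^ L, MeasurableSet (E i)) (hχ : 0 ≤ χ)
    (hgt : ∀ j < 2 ^ L, ∀ i ≤ 2 ^ L, j < i → r + χ ≤ (P j).real (E i))
    (hle : ∀ j < 2 ^ L, ∀ i ≤ 2 ^ L, i ≤ j → (P j).real (E i) ≤ r - χ)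
    (hTδ : T * δ ≤ 1 / 3) (hT : L * Real.exp (-2 * χ ^ 2 * T) ≤ 1 / 3) :
    (2 : ℝ) ^ L ≤ 3 * Real.exp (T * ε) := by
  classical
  have hP0 : IsProbabilityMeasure (P 0) := hP 0 (by positivity)
  -- The event that the comparison with `searchPoint l j` goes wrong for `j`.
  let bad : ℕ → ℕ → Set (Fin T → Ω) := fun j l =>
    if j < searchPoint l j then {ω | hits (E (searchPoint l j)) ω ≤ T * r}
    else {ω | T * r < hits (E (searchPoint l j)) ω}
  let good : ℕ → Set (Fin T → Ω) := fun j => (⋃ l ∈ Finset.range L, bad j l)ᶜ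
  have hbadm : ∀ j < 2 ^ L, ∀ l < L, MeasurableSet (bad j l) := by
    intro j hj l hl
    have hm := measurable_hits (T := T) (hE _ (searchPoint_le hl hj))
    simp only [bad]
    split_ifs
    · exact measurableSet_le hm measurable_const
    · exact measurableSet_lt measurable_const hm
  have hgoodm : ∀ j < 2 ^ L, MeasurableSet (good j) := fun j hj =>
    (Finset.measurableSet_biUnion _ fun l hl => hbadm j hj l (Finset.mem_range.1 hl)).compl
  have hgood : ∀ j < 2 ^ L, 2 / 3 ≤ (Measure.pi fun _ : Fin T => P j).real (good j) := by
    intro j hj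
    have := hP j hj
    have hb : (Measure.pi fun _ : Fin T => P j).real (⋃ l ∈ Finset.range L, bad j l) ≤ 1 / 3 := by
      refine (measureReal_biUnion_finset_le _ _).trans (le_trans ?_ hT)
      refine (Finset.sum_le_card_nsmul _ _ (Real.exp (-2 * χ ^ 2 * T)) fun l hl => ?_).trans_eq
        (by rw [Finset.card_range, nsmul_eq_mul])
      have hsl := searchPoint_le (Finset.mem_range.1 hl) hj
      simp only [bad]
      split_ifs with h
      · exact measureReal_hits_le_le _ (hE _ hsl) hχ (hgt j hj _ hsl h)
      · exact measureReal_hits_gt_le _ (hE _ hsl) hχ (hle j hj _ hsl (not_lt.1 h))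
    simp only [good]
    rw [probReal_compl_eq_one_sub (Finset.measurableSet_biUnion _
      fun l hl => hbadm j hj l (Finset.mem_range.1 hl))]
    linarith
  have hdisj : ∀ j < 2 ^ L, ∀ j' < 2 ^ L, j < j' → Disjoint (good j) (good j') := by
    intro j hj j' hj' hjj
    obtain ⟨l, hl, h1, h2, h3⟩ := exists_searchPoint_separates hj hj' hjj
    rw [Set.disjoint_left]
    intro ω hω hω'
    have e1 : ω ∉ bad j l := fun h => hω (Set.mem_biUnion (Finset.mem_range.2 hl) h)
    have e2 : ω ∉ bad j' l := fun h => hω' (Set.mem_biUnion (Finset.mem_range.2 hl) h)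
    simp only [bad, h2, if_true, Set.mem_ofPred_eq, not_le] at e1
    simp only [bad, ← h1, not_lt.2 h3, if_false, Set.mem_ofPred_eq, not_lt] at e2
    linarith
  have hlow : ∀ j < 2 ^ L, 1 / 3 ≤
      Real.exp (T * ε) * (Measure.pi fun _ : Fin T => P 0).real (good j) := by
    intro j hj
    have := hP j hj
    have h1 := ((hind j hj).pi T _ (hgoodm j hj)).1
    have h2 := hgood j hj
    linarith
  have hsum : ∑ j ∈ Finset.range (2 ^ L), (Measure.pi fun _ : Fin T => P 0).real (good j) ≤ 1 := by
    rw [← measureReal_biUnion_finset]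
    · exact measureReal_le_one
    · intro j hj j' hj' hjj
      rw [Finset.mem_coe, Finset.mem_range] at hj hj'
      rcases lt_or_gt_of_ne hjj with h | h
      · exact hdisj j hj j' hj' h
      · exact (hdisj j' hj' j hj h).symm
    · exact fun j hj => hgoodm j (Finset.mem_range.1 hj)
  have h1 : ∑ j ∈ Finset.range (2 ^ L), (1 / 3 : ℝ) ≤ Real.exp (T * ε) *
      ∑ j ∈ Finset.range (2 ^ L), (Measure.pi fun _ : Fin T => P 0).real (good j) := by
    rw [Finset.mul_sum]
    exact Finset.sum_le_sum fun j hj => hlow j (Finset.mem_range.1 hj)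
  rw [Finset.sum_const, Finset.card_range, nsmul_eq_mul] at h1
  push_cast at h1
  nlinarith [Real.exp_pos (T * ε)]

/-! ### Homogeneous sets for functions of samples -/

/-- The number of points of `y` below `x`. -/
def rank {α : Type*} [LinearOrder α] {m : ℕ} (y : Fin m → α) (x : α) : Fin (m + 1) :=
  ⟨(Finset.univ.filter fun l => y l < x).card,
    Nat.lt_succ_of_le ((Finset.card_le_univ _).trans_eq (Fintype.card_fin m))⟩

theorem lt_iff_lt_rank {α : Type*} [LinearOrder α] {m : ℕ} {y : Fin m → α} (hy : StrictMono y)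
    (x : α) (l : Fin m) : y l < x ↔ (l : ℕ) < rank y x := by
  constructor
  · intro h
    have : Finset.Iic l ⊆ Finset.univ.filter fun l => y l < x := fun l' hl' =>
      Finset.mem_filter.2 ⟨Finset.mem_univ _, (hy.monotone (Finset.mem_Iic.1 hl')).trans_lt h⟩
    have := Finset.card_le_card this
    rw [Fin.card_Iic] at this
    exact this
  · intro h
    by_contra hn
    have : (Finset.univ.filter fun l => y l < x) ⊆ Finset.Iio l := fun l' hl' =>
      Finset.mem_Iio.2 (hy.lt_iff_lt.1 ((Finset.mem_filter.1 hl').2.trans_le (not_lt.1 hn)))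
    have := Finset.card_le_card this
    rw [Fin.card_Iio] at this
    exact absurd h (not_lt.2 this)

theorem rank_eq {α : Type*} [LinearOrder α] {m : ℕ} {y : Fin m → α} (hy : StrictMono y)
    {x : α} {k : ℕ} (hk : k ≤ m) (h : ∀ l, y l < x ↔ (l : ℕ) < k) : (rank y x : ℕ) = k := by
  have h' : ∀ l : Fin m, (l : ℕ) < rank y x ↔ (l : ℕ) < k := fun l => by
    rw [← lt_iff_lt_rank hy, h]
  have hr : (rank y x : ℕ) ≤ m := Nat.lt_succ_iff.1 (rank y x).2
  rcases lt_trichotomy (rank y x : ℕ) k with hlt | heq | hgt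
  · exact absurd ((h' ⟨rank y x, by omega⟩).2 hlt) (lt_irrefl _)
  · exact heq
  · exact absurd ((h' ⟨k, by omega⟩).1 hgt) (lt_irrefl _)

theorem strictMono_insertNth_rank {α : Type*} [LinearOrder α] {m : ℕ} {y : Fin m → α}
    (hy : StrictMono y) {x : α} (hx : ∀ l, y l ≠ x) :
    StrictMono (Fin.insertNth (α := fun _ => α) (rank y x) x y) := by
  intro a b hab
  rcases Fin.eq_self_or_eq_succAbove (rank y x) a with rfl | ⟨l, rfl⟩
  · rcases Fin.eq_self_or_eq_succAbove (rank y x) b with rfl | ⟨l, rfl⟩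
    · exact absurd hab (lt_irrefl _)
    · rw [Fin.insertNth_apply_same, Fin.insertNth_apply_succAbove]
      rw [Fin.lt_succAbove_iff_le_castSucc, Fin.le_def, Fin.val_castSucc] at hab
      exact lt_of_le_of_ne (not_lt.1 fun h => absurd ((lt_iff_lt_rank hy x l).1 h)
        (not_lt.2 hab)) (hx l).symm
  · rcases Fin.eq_self_or_eq_succAbove (rank y x) b with rfl | ⟨l', rfl⟩
    · rw [Fin.insertNth_apply_same, Fin.insertNth_apply_succAbove]
      rw [Fin.succAbove_lt_iff_castSucc_lt, Fin.lt_def, Fin.val_castSucc] at hab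
      exact (lt_iff_lt_rank hy x l).2 hab
    · rw [Fin.insertNth_apply_succAbove, Fin.insertNth_apply_succAbove]
      exact hy ((Fin.strictMono_succAbove _).lt_iff_lt.1 hab)

/-- A function of a labelled sample and a query point is, up to an error `1 / Q` and after
restriction to a large subset, a function of the order type of the sample and of the rank of the
query point among the points of the sample. Here a sample is given by its sorted points `y` and by
the map `g` from the indices of the examples to the rank and the label of the example. -/
theorem exists_homogeneous_of_sample {α : Type*} [LinearOrder α] {m q Q N : ℕ} (hQ : 0 < Q)
    (hq : 2 ≤ q) (hcard : ((Q + 1) ^ (m + 1)) ^ (m * 2) ^ m ≤ q)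
    (a : (Fin m → α × Bool) → α → ℝ) (ha : ∀ S x, a S x ∈ Set.Icc (0 : ℝ) 1) {V : Finset α}
    (hV : ramseyBound q N (m + 1) ≤ V.card) :
    ∃ (w : Fin N ↪o α) (v : (Fin m → Fin m × Bool) → Fin (m + 1) → ℝ),
      ∀ (g : Fin m → Fin m × Bool) (y : Fin m → Fin N), StrictMono y →
        ∀ x : Fin N, (∀ l, y l ≠ x) →
          |a (fun t => (w (y (g t).1), (g t).2)) (w x) - v g (rank y x)| ≤ 1 / Q := by
  classical
  let c : Finset α → (Fin m → Fin m × Bool) → Fin (m + 1) → Fin (Q + 1) := fun s g i =>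
    if h : s.card = m + 1 then
      ⟨min Q ⌊Q * a (fun t => (s.orderEmbOfFin h (i.succAbove (g t).1), (g t).2))
        (s.orderEmbOfFin h i)⌋₊, by omega⟩
    else 0
  obtain ⟨W, -, hWc, k, hk⟩ := exists_homogeneous hq
    (by simpa [Fintype.card_pi, Fintype.card_prod] using hcard) (m + 1) hV c
  refine ⟨W.orderEmbOfFin hWc, fun g i => ((k g i : ℕ) : ℝ) / Q, fun g y hy x hx => ?_⟩
  set w := W.orderEmbOfFin hWc
  set i := rank y x
  set z : Fin (m + 1) → α := fun b => w (Fin.insertNth (α := fun _ => Fin N) i x y b) with hz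
  have hzm : StrictMono z := w.strictMono.comp (strictMono_insertNth_rank hy hx)
  set s : Finset α := Finset.univ.image z with hs
  have hsc : s.card = m + 1 := by
    rw [hs, Finset.card_image_of_injective _ hzm.injective, Finset.card_univ, Fintype.card_fin]
  have hsz : z = s.orderEmbOfFin hsc :=
    Finset.orderEmbOfFin_unique hsc (fun b => Finset.mem_image_of_mem _ (Finset.mem_univ _)) hzm
  have hsW : s ⊆ W := by
    intro b hb
    obtain ⟨b', -, rfl⟩ := Finset.mem_image.1 hb
    exact Finset.orderEmbOfFin_mem _ _ _
  have hck := congrArg (fun f => ((f g i : Fin (Q + 1)) : ℕ)) (hk s hsW hsc)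
  simp only [c, dif_pos hsc, ← hsz] at hck
  have hzi : z i = w x := by simp [hz]
  have hzs : ∀ l, z (i.succAbove l) = w (y l) := by simp [hz]
  simp only [hzi, hzs] at hck
  set u := a (fun t => (w (y (g t).1), (g t).2)) (w x)
  obtain ⟨hu0, hu1⟩ : u ∈ Set.Icc (0 : ℝ) 1 := ha _ _
  have hQ' : (0 : ℝ) < Q := by exact_mod_cast hQ
  have hfl : ⌊Q * u⌋₊ ≤ Q := by
    refine (Nat.floor_le_floor (mul_le_of_le_one_right hQ'.le hu1)).trans ?_
    simp
  rw [min_eq_right hfl] at hck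
  simp only
  rw [← hck]
  have h1 := Nat.floor_le (mul_nonneg hQ'.le hu0)
  have h2 := Nat.lt_floor_add_one (Q * u)
  rw [show u - (⌊Q * u⌋₊ : ℝ) / Q = (Q * u - ⌊Q * u⌋₊) / Q by field_simp, abs_of_nonneg
    (div_nonneg (by linarith) hQ'.le)]
  exact div_le_div_of_nonneg_right (by linarith) hQ'.le

/-! ### Accurate learners on uniform distributions -/

/-- The uniform distribution on the points `w i`, with label `+1` exactly for `K ≤ i`. -/
noncomputable def labelledUniform {X : Set ℝ} {N : ℕ} (w : Fin N → X) (K : ℕ) :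
    Measure (X × Label) :=
  (N : ENNReal)⁻¹ • ∑ i : Fin N, Measure.dirac (w i, decide (K ≤ (i : ℕ)))

theorem labelledUniform_apply {X : Set ℝ} {N : ℕ} (w : Fin N → X) (K : ℕ)
    (s : Set (X × Label)) [DecidablePred (· ∈ s)] : labelledUniform w K s =
      (N : ENNReal)⁻¹ * (Finset.univ.filter fun i : Fin N =>
        (w i, decide (K ≤ (i : ℕ))) ∈ s).card := by
  classical
  rw [labelledUniform, Measure.smul_apply, Measure.finsetSum_apply, smul_eq_mul]
  congr 1
  simp [Measure.dirac_apply, Set.indicator_apply]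

theorem isProbabilityMeasure_labelledUniform {X : Set ℝ} {N : ℕ} (hN : 0 < N) (w : Fin N → X)
    (K : ℕ) : IsProbabilityMeasure (labelledUniform w K) := by
  classical
  constructor
  rw [labelledUniform_apply]
  simp [ENNReal.inv_mul_cancel, hN.ne']

theorem loss_labelledUniform {X : Set ℝ} {N : ℕ} (w : Fin N → X) (K : ℕ) (h : Hypothesis X) :
    loss (labelledUniform w K) h =
      (Finset.univ.filter fun i : Fin N => h (w i) ≠ decide (K ≤ (i : ℕ))).card / N := by
  classical
  rw [loss, measureReal_def, labelledUniform_apply, ENNReal.toReal_mul, ENNReal.toReal_inv]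
  simp [div_eq_inv_mul]

theorem realizable_labelledUniform {X : Set ℝ} {N : ℕ} (w : Fin N ↪o X) {K : ℕ} (hK : K < N) :
    Realizable (thresholds X) (labelledUniform w K) := by
  refine ⟨fun x => decide (w ⟨K, hK⟩ ≤ x), ⟨w ⟨K, hK⟩, fun x => by simp⟩, ?_⟩
  rw [loss_labelledUniform]
  simp [Fin.le_def]

/-- If a set `U` contains at least half of all samples from a uniform distribution, then an accurate
learner does well on some sample in `U`. -/
theorem LearningAlgorithm.Accurate.exists_sample {X : Set ℝ} {m : ℕ} {A : LearningAlgorithm X m}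
    (hA : A.Accurate (1 / 16) (1 / 16) (thresholds X)) {N : ℕ} (w : Fin N ↪o X) {K : ℕ}
    (hK : K < N) (U : Finset (Fin m → Fin N)) (hU : N ^ m ≤ 2 * U.card) :
    ∃ u ∈ U, @Measure.real _ A.events (A.out fun t => (w (u t), decide (K ≤ (u t : ℕ))))
      {h | 1 / 16 < loss (labelledUniform w K) h} ≤ 1 / 7 := by
  classical
  let := A.events
  have hN : 0 < N := by omega
  have := isProbabilityMeasure_labelledUniform hN w K
  by_contra! hcon
  set D := labelledUniform w K with hD
  let f : (Fin m → Fin N) → Sample X m := fun u t => (w (u t), decide (K ≤ (u t : ℕ)))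
  have hf : Function.Injective f := fun u u' h => funext fun t =>
    w.injective (congrArg Prod.fst (congrFun h t))
  have hacc := hA D this (realizable_labelledUniform w hK)
  have h1 : ∀ u ∈ U, ENNReal.ofReal (1 / 7) * ENNReal.ofReal ((N : ℝ)⁻¹ ^ m) ≤
      A.out (f u) {h | 1 / 16 < loss D h} * (Measure.pi fun _ : Fin m => D) {f u} := by
    intro u hu
    have := A.isProbabilityMeasure_out (f u)
    refine mul_le_mul' ?_ ?_
    · rw [ENNReal.ofReal_le_iff_le_toReal (measure_ne_top _ _)]
      exact (hcon u hu).le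
    · rw [Measure.pi_singleton, ENNReal.ofReal_pow (by positivity)]
      calc _ = ∏ _t : Fin m, ENNReal.ofReal ((N : ℝ)⁻¹) := by simp
        _ ≤ _ := Finset.prod_le_prod' fun t _ => by
          rw [hD, labelledUniform_apply, ENNReal.ofReal_inv_of_pos (by exact_mod_cast hN),
            ENNReal.ofReal_natCast]
          refine le_mul_of_one_le_right' ?_
          exact_mod_cast Finset.card_pos.2 ⟨u t, by simp [f]⟩
  have h2 : ∑ u ∈ U, A.out (f u) {h | 1 / 16 < loss D h} *
      (Measure.pi fun _ : Fin m => D) {f u} ≤ ENNReal.ofReal (1 / 16) := by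
    refine le_trans ?_ hacc
    refine le_trans (le_of_eq ?_) (setLIntegral_le_lintegral (↑(U.image f)) _)
    rw [lintegral_finset, Finset.sum_image hf.injOn]
  have h3 := (Finset.sum_le_sum h1).trans h2
  rw [Finset.sum_const, nsmul_eq_mul, ← ENNReal.ofReal_mul (by norm_num),
    ← ENNReal.ofReal_natCast, ← ENNReal.ofReal_mul (by positivity),
    ENNReal.ofReal_le_ofReal_iff (by norm_num)] at h3
  have hU' : (N : ℝ) ^ m ≤ 2 * U.card := by exact_mod_cast hU
  have hp : (0 : ℝ) < (N : ℝ) ^ m := by positivity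
  rw [inv_pow] at h3
  have h4 : (U.card : ℝ) / (N : ℝ) ^ m ≥ 1 / 2 := by
    rw [ge_iff_le, le_div_iff₀ hp]; linarith
  have h5 : (U.card : ℝ) * (1 / 7 * ((N : ℝ) ^ m)⁻¹) = (U.card : ℝ) / (N : ℝ) ^ m / 7 := by
    field_simp
  rw [h5] at h3
  linarith

/-- The probability that the output of `A` on `S` takes the value `+1` at `x`. -/
noncomputable def LearningAlgorithm.prob {X : Set ℝ} {m : ℕ} (A : LearningAlgorithm X m)
    (S : Sample X m) (x : X) : ℝ :=
  @Measure.real _ A.events (A.out S) {h | h x = true}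

theorem LearningAlgorithm.measurableSet_apply_eq {X : Set ℝ} {m : ℕ} (A : LearningAlgorithm X m)
    (x : X) (b : Bool) : MeasurableSet[A.events] {h : Hypothesis X | h x = b} :=
  let := A.events
  A.measurable_eval x (measurableSet_singleton b)

theorem LearningAlgorithm.prob_mem_Icc {X : Set ℝ} {m : ℕ} (A : LearningAlgorithm X m)
    (S : Sample X m) (x : X) : A.prob S x ∈ Set.Icc (0 : ℝ) 1 :=
  let := A.events
  haveI := A.isProbabilityMeasure_out S
  ⟨measureReal_nonneg, measureReal_le_one⟩

theorem LearningAlgorithm.measureReal_apply_eq_false {X : Set ℝ} {m : ℕ}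
    (A : LearningAlgorithm X m) (S : Sample X m) (x : X) :
    @Measure.real _ A.events (A.out S) {h | h x = false} = 1 - A.prob S x := by
  let := A.events
  have := A.isProbabilityMeasure_out S
  rw [LearningAlgorithm.prob, ← probReal_compl_eq_one_sub (A.measurableSet_apply_eq x true)]
  congr 1
  ext h
  simp

/-- The expected number of errors on the support of the distribution. -/
theorem LearningAlgorithm.sum_error_le {X : Set ℝ} {m : ℕ} (A : LearningAlgorithm X m)
    {N : ℕ} (hN : 0 < N) (w : Fin N → X) (K : ℕ) (S : Sample X m)
    (hS : @Measure.real _ A.events (A.out S)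
      {h | 1 / 16 < loss (labelledUniform w K) h} ≤ 1 / 7) :
    ∑ i : Fin N, @Measure.real _ A.events (A.out S) {h | h (w i) = !decide (K ≤ (i : ℕ))} ≤
      N * (1 / 16 + 1 / 7) := by
  classical
  let := A.events
  have := A.isProbabilityMeasure_out S
  have hN' : (0 : ℝ) < N := by exact_mod_cast hN
  let F : Fin N → Set (Hypothesis X) := fun i => {h | h (w i) = !decide (K ≤ (i : ℕ))}
  have hFm : ∀ i, MeasurableSet (F i) := fun i => A.measurableSet_apply_eq _ _
  have hFint : ∀ i, Integrable ((F i).indicator fun _ => (1 : ℝ)) (A.out S) := fun i =>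
    (integrable_const _).indicator (hFm i)
  have hloss : ∀ h, ∑ i, (F i).indicator (fun _ => (1 : ℝ)) h =
      N * loss (labelledUniform w K) h := by
    intro h
    rw [loss_labelledUniform, mul_div_cancel₀ _ hN'.ne']
    simp [F, Set.indicator_apply, ← Bool.eq_not]
  have hBm : MeasurableSet {h | 1 / 16 < loss (labelledUniform w K) h} := by
    have : Measurable fun h => loss (labelledUniform w K) h := by
      have : (fun h => loss (labelledUniform w K) h) =
          fun h => (N : ℝ)⁻¹ * ∑ i, (F i).indicator (fun _ => (1 : ℝ)) h := by
        funext h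
        rw [hloss, inv_mul_cancel_left₀ hN'.ne']
      rw [this]
      exact (Finset.measurable_sum _ fun i _ => measurable_const.indicator (hFm i)).const_mul _
    exact measurableSet_lt measurable_const this
  set B := {h | 1 / 16 < loss (labelledUniform w K) h} with hB
  calc ∑ i : Fin N, (A.out S).real (F i)
      = ∫ h, ∑ i, (F i).indicator (fun _ => (1 : ℝ)) h ∂(A.out S) := by
        rw [integral_finsetSum _ fun i _ => hFint i]
        exact Finset.sum_congr rfl fun i _ => (integral_indicator_one (hFm i)).symm
    _ ≤ ∫ h, N * (1 / 16 + B.indicator (fun _ => (1 : ℝ)) h) ∂(A.out S) := by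
        refine integral_mono (integrable_finsetSum _ fun i _ => hFint i)
          (((integrable_const _).add ((integrable_const _).indicator hBm)).const_mul _)
          fun h => ?_
        simp only [hloss]
        refine mul_le_mul_of_nonneg_left ?_ hN'.le
        by_cases hh : h ∈ B
        · rw [Set.indicator_of_mem hh]
          have := isProbabilityMeasure_labelledUniform hN w K
          have : loss (labelledUniform w K) h ≤ 1 := measureReal_le_one
          linarith
        · rw [Set.indicator_of_notMem hh, add_zero]
          exact not_lt.1 hh
    _ = N * (1 / 16 + (A.out S).real B) := by
        rw [integral_const_mul, integral_add (integrable_const _)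
          ((integrable_const _).indicator hBm)]
        have : ∫ h, B.indicator (fun _ => (1 : ℝ)) h ∂(A.out S) = (A.out S).real B :=
          integral_indicator_one hBm
        rw [this]
        simp
    _ ≤ _ := by gcongr

/-! ### A private learner distinguishes neighbouring positions of one example -/

theorem pow_le_two_mul_card_injective {m N : ℕ} (hN : 2 * m ^ 2 ≤ N) :
    N ^ m ≤ 2 * (Finset.univ.filter fun u : Fin m → Fin N => Function.Injective u).card := by
  classical
  have hcard : (Finset.univ.filter fun u : Fin m → Fin N => Function.Injective u).card =
      N.descFactorial m := by
    rw [← Fintype.card_subtype,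
      Fintype.card_congr (Equiv.subtypeInjectiveEquivEmbedding (Fin m) (Fin N)),
      Fintype.card_embedding_eq, Fintype.card_fin, Fintype.card_fin]
  rw [hcard]
  rcases Nat.eq_zero_or_pos m with rfl | hm
  · simp
  have hmN : m ≤ N := by nlinarith
  have hN0 : (0 : ℝ) < N := by exact_mod_cast lt_of_lt_of_le hm hmN
  have h1 : (N - m) ^ m ≤ N.descFactorial m :=
    (Nat.pow_le_pow_left (by omega) m).trans (Nat.pow_sub_le_descFactorial N m)
  have h2 : (1 : ℝ) / 2 ≤ (1 - m / N) ^ m := by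
    have hb := one_add_mul_le_pow (a := -(m / N : ℝ)) (by
      have : (m : ℝ) / N ≤ 1 := by
        rw [div_le_one hN0]; exact_mod_cast hmN
      linarith) m
    have h3 : (m : ℝ) * (m / N) ≤ 1 / 2 := by
      rw [← mul_div_assoc, div_le_iff₀ hN0]
      have : (2 : ℝ) * m ^ 2 ≤ N := by exact_mod_cast hN
      linarith
    rw [← sub_eq_add_neg] at hb
    linarith
  have h4 : ((N : ℝ) - m) ^ m = (1 - m / N) ^ m * N ^ m := by
    rw [← mul_pow, sub_mul, one_mul, div_mul_cancel₀ _ hN0.ne']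
  have h5 : ((N : ℝ) - m) ^ m ≤ N.descFactorial m := by
    rw [← Nat.cast_sub hmN]
    exact_mod_cast h1
  have h6 : (N : ℝ) ^ m ≤ 2 * N.descFactorial m := by
    rw [h4] at h5
    nlinarith [pow_pos hN0 m]
  exact_mod_cast h6

theorem sub_le_mul_of_forall_step_lt {v : ℕ → ℝ} {a b : ℕ} {d : ℝ} (hab : a ≤ b)
    (h : ∀ k, a ≤ k → k < b → v (k + 1) - v k < d) : v b - v a ≤ (b - a) * d := by
  induction b, hab using Nat.le_induction with
  | base => simp
  | succ b hab ih =>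
    have h1 := ih fun k hk hkb => h k hk (by omega)
    have h2 := h b hab (Nat.lt_succ_self b)
    push_cast
    linarith

/-- A uniformly distributed sample is injective with probability at least `1 / 2`, so an accurate
learner has small expected error on some injective sample. By homogeneity its predictions outside
the sample depend only on the gap in the sample. They are mostly `-1` on the left half of the domain
and mostly `+1` on the right half, so they must change noticeably between two adjacent gaps. -/
theorem exists_jump {X : Set ℝ} {m K : ℕ} {A : LearningAlgorithm X m}
    (hA : A.Accurate (1 / 16) (1 / 16) (thresholds X)) (hm : 2 ≤ m)
    (w : Fin (2 * K) ↪o X) (hK : 50 * m ≤ K) (hK2 : m ^ 2 ≤ K)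
    (v : (Fin m → Fin m × Bool) → Fin (m + 1) → ℝ)
    (hv : ∀ (g : Fin m → Fin m × Bool) (y : Fin m → Fin (2 * K)), StrictMono y →
        ∀ x : Fin (2 * K), (∀ l, y l ≠ x) →
          |A.prob (fun t => (w (y (g t).1), (g t).2)) (w x) - v g (rank y x)| ≤ 1 / (100 * m)) :
    ∃ g : Fin m → Fin m × Bool, Function.Injective (fun t => (g t).1) ∧
      ∃ k : Fin m, 14 / 100 / m ≤ v g k.succ - v g k.castSucc := by
  classical
  obtain ⟨u, hu, hS⟩ := hA.exists_sample w (K := K) (by omega) _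
    (pow_le_two_mul_card_injective (m := m) (by omega))
  have huinj : Function.Injective u := (Finset.mem_filter.1 hu).2
  have hm0 : (0 : ℝ) < m := by positivity
  have hmK : (50 : ℝ) * m ≤ K := by exact_mod_cast hK
  set S : Sample X m := fun t => (w (u t), decide (K ≤ (u t : ℕ))) with hSdef
  have herr := A.sum_error_le (by omega) w K S hS
  push_cast at herr
  -- The points of the sample, sorted.
  set y : Fin m → Fin (2 * K) := u ∘ Tuple.sort u with hy
  have hym : StrictMono y :=
    (Tuple.monotone_sort u).strictMono_of_injective (huinj.comp (Tuple.sort u).injective)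
  set g : Fin m → Fin m × Bool :=
    fun t => ((Tuple.sort u).symm t, decide (K ≤ (u t : ℕ))) with hg
  have hSg : (fun t => (w (y (g t).1), (g t).2)) = S := by
    funext t
    simp [hSdef, hy, hg]
  have hyu : ∀ x, (∀ t, u t ≠ x) → ∀ l, y l ≠ x := fun x hx l => hx _
  refine ⟨g, (Tuple.sort u).symm.injective, ?_⟩
  have hvS : ∀ x, (∀ t, u t ≠ x) → |A.prob S (w x) - v g (rank y x)| ≤ 1 / (100 * m) := by
    intro x hx
    have := hv g y hym x (hyu x hx)
    rwa [hSg] at this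
  -- A half of the domain contains a point outside the sample with error probability at most `0.42`,
  -- because the total error is at most `(1 / 16 + 1 / 7) * (2 * K) < 0.42 * (49 / 50) * K`.
  have hhalf : ∀ H : Finset (Fin (2 * K)), H.card = K → ∃ x ∈ H, (∀ t, u t ≠ x) ∧
      @Measure.real _ A.events (A.out S) {h | h (w x) = !decide (K ≤ (x : ℕ))} ≤ 42 / 100 := by
    intro H hH
    by_contra! hcon
    set H' := H \ Finset.univ.image u with hH'
    have hcardH' : (K : ℝ) - m ≤ H'.card := by
      have h1 := Finset.le_card_sdiff (Finset.univ.image u) H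
      have h2 : (Finset.univ.image u).card ≤ m := by
        simpa using (Finset.card_image_le : (Finset.univ.image u).card ≤ _)
      have h3 : K ≤ H'.card + m := by
        rw [hH] at h1
        rw [hH']
        omega
      have : (K : ℝ) ≤ H'.card + m := by exact_mod_cast h3
      linarith
    have h1 : ∑ x ∈ H', (42 / 100 : ℝ) ≤ ∑ x ∈ H',
        @Measure.real _ A.events (A.out S) {h | h (w x) = !decide (K ≤ (x : ℕ))} :=
      Finset.sum_le_sum fun x hx => by
        rw [hH', Finset.mem_sdiff] at hx
        exact (hcon x hx.1 fun t ht => hx.2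
          (Finset.mem_image.2 ⟨t, Finset.mem_univ _, ht⟩)).le
    have h2 : ∑ x ∈ H',
        @Measure.real _ A.events (A.out S) {h | h (w x) = !decide (K ≤ (x : ℕ))} ≤
        ∑ x, @Measure.real _ A.events (A.out S) {h | h (w x) = !decide (K ≤ (x : ℕ))} := by
      let := A.events
      exact Finset.sum_le_sum_of_subset_of_nonneg (Finset.subset_univ _)
        fun _ _ _ => measureReal_nonneg
    rw [Finset.sum_const, nsmul_eq_mul] at h1
    linarith
  have hcK : (Finset.univ.filter fun x : Fin (2 * K) => (x : ℕ) < K).card = K := by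
    rw [Fin.card_filter_val_lt]; omega
  have hcK' : (Finset.univ.filter fun x : Fin (2 * K) => ¬ (x : ℕ) < K).card = K := by
    have := Finset.card_filter_add_card_filter_not (s := (Finset.univ : Finset (Fin (2 * K))))
      (fun x => (x : ℕ) < K)
    rw [hcK, Finset.card_univ, Fintype.card_fin] at this
    omega
  obtain ⟨x, hxH, hxu, hx⟩ := hhalf _ hcK
  obtain ⟨x', hxH', hxu', hx'⟩ := hhalf _ hcK'
  replace hxH := (Finset.mem_filter.1 hxH).2
  replace hxH' := not_lt.1 (Finset.mem_filter.1 hxH').2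
  rw [decide_eq_false (by omega : ¬ K ≤ (x : ℕ)), Bool.not_false] at hx
  rw [decide_eq_true hxH', Bool.not_true, A.measureReal_apply_eq_false] at hx'
  change A.prob S (w x) ≤ _ at hx
  have hb := abs_le.1 (hvS x hxu)
  have hb' := abs_le.1 (hvS x' hxu')
  have hrank : (rank y x : ℕ) ≤ rank y x' := by
    have hxx : x < x' := by rw [Fin.lt_def]; omega
    refine Finset.card_le_card (s := Finset.univ.filter fun l => y l < x)
      (t := Finset.univ.filter fun l => y l < x') fun l hl => ?_
    exact Finset.mem_filter.2 ⟨Finset.mem_univ _, (Finset.mem_filter.1 hl).2.trans hxx⟩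
  have hγ : (1 : ℝ) / (100 * m) ≤ 1 / 200 := by
    apply one_div_le_one_div_of_le (by norm_num)
    have : (2 : ℝ) ≤ m := by exact_mod_cast hm
    linarith
  by_contra! hcon
  have hstep := sub_le_mul_of_forall_step_lt (v := fun k => v g (Fin.ofNat (m + 1) k)) (d := 14 / 100 / m)
    hrank fun k hk hk' => by
      have hkm : k < m := by have := (rank y x').2; omega
      have h1 : Fin.ofNat (m + 1) k = (⟨k, hkm⟩ : Fin m).castSucc :=
        Fin.ext (by simp [Nat.mod_eq_of_lt (by omega : k < m + 1)])
      have h2 : Fin.ofNat (m + 1) (k + 1) = (⟨k, hkm⟩ : Fin m).succ :=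
        Fin.ext (by simp [Nat.mod_eq_of_lt (by omega : k + 1 < m + 1)])
      simp only [h1, h2]
      exact hcon _
  have h1 : ∀ i : Fin (m + 1), Fin.ofNat (m + 1) (i : ℕ) = i := fun i => by simp
  simp only [h1] at hstep
  have h2 : (((rank y x' : ℕ) : ℝ) - (rank y x : ℕ)) * (14 / 100 / m) ≤ 14 / 100 := by
    have : ((rank y x' : ℕ) : ℝ) - (rank y x : ℕ) ≤ m := by
      have h3 : ((rank y x' : ℕ) : ℝ) ≤ m := by exact_mod_cast Nat.lt_succ_iff.1 (rank y x').2
      have h4 : (0 : ℝ) ≤ (rank y x : ℕ) := by positivity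
      linarith
    calc _ ≤ (m : ℝ) * (14 / 100 / m) := by gcongr
      _ = 14 / 100 := by field_simp
  linarith [hb.1, hb.2, hb'.1, hb'.2]

theorem Indistinguishable.refl {Ω : Type*} [MeasurableSpace Ω] {ε δ : ℝ} (hε : 0 ≤ ε)
    (hδ : 0 ≤ δ) (p : Measure Ω) : Indistinguishable ε δ p p := fun E _ => by
  have h : p.real E ≤ Real.exp ε * p.real E + δ := by
    nlinarith [Real.one_le_exp hε, measureReal_nonneg (μ := p) (s := E)]
  exact ⟨h, h⟩

/-- The point of rank `l` in a sample of `m` points of `Fin N` whose point of rank `k` is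
`k + 1 + 2 * j`; the points of lower rank are the smallest elements of `Fin N` and those of higher
rank the largest. The points `k + 2 * i` in between are left for queries. -/
def slidingPoint (N m k j l : ℕ) : ℕ :=
  if l < k then l else if l = k then k + 1 + 2 * j else N - m + l

/-- If the predictions of a private algorithm jump at the `k`-th point of the sample, then by moving
this point among `2 ^ T` positions one gets indistinguishable distributions over hypotheses that
the values at the points between the positions tell apart. -/
theorem LearningAlgorithm.DifferentiallyPrivate.two_pow_le {X : Set ℝ} {m N T : ℕ} {ε δ : ℝ}
    {A : LearningAlgorithm X m} (hA : A.DifferentiallyPrivate ε δ) (hε : 0 ≤ ε) (hT0 : 0 < T)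
    (w : Fin N ↪o X) (hN : m + 2 * 2 ^ T + 1 ≤ N) (v : Fin (m + 1) → ℝ) {γ χ : ℝ} (hχ : 0 ≤ χ)
    {g : Fin m → Fin m × Bool} (hg : Function.Injective fun t => (g t).1)
    (hv : ∀ (y : Fin m → Fin N), StrictMono y → ∀ x : Fin N, (∀ l, y l ≠ x) →
        |A.prob (fun t => (w (y (g t).1), (g t).2)) (w x) - v (rank y x)| ≤ γ)
    (k : Fin m) (hk : 2 * χ + 2 * γ ≤ v k.succ - v k.castSucc)
    (hTδ : T * δ ≤ 1 / 3) (hT : T * Real.exp (-2 * χ ^ 2 * T) ≤ 1 / 3) :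
    (2 : ℝ) ^ T ≤ 3 * Real.exp (T * ε) := by
  have hN0 : 0 < N := by omega
  have : NeZero N := ⟨hN0.ne'⟩
  let y : ℕ → Fin m → Fin N := fun j l => Fin.ofNat N (slidingPoint N m k j l)
  let x : ℕ → Fin N := fun i => Fin.ofNat N (k + 2 * i)
  have hyval : ∀ j < 2 ^ T, ∀ l, ((y j l : Fin N) : ℕ) = slidingPoint N m k j l := by
    intro j hj l
    refine Nat.mod_eq_of_lt ?_
    unfold slidingPoint
    split_ifs <;> omega
  have hxval : ∀ i ≤ 2 ^ T, ((x i : Fin N) : ℕ) = k + 2 * i := by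
    intro i hi
    exact Nat.mod_eq_of_lt (by omega)
  have hym : ∀ j < 2 ^ T, StrictMono (y j) := by
    intro j hj l l' hl
    rw [Fin.lt_def, hyval j hj, hyval j hj]
    rw [Fin.lt_def] at hl
    unfold slidingPoint
    split_ifs <;> omega
  have hyx : ∀ j < 2 ^ T, ∀ i ≤ 2 ^ T, ∀ l, y j l ≠ x i := by
    intro j hj i hi l h
    have := congrArg Fin.val h
    rw [hyval j hj, hxval i hi] at this
    unfold slidingPoint at this
    split_ifs at this <;> omega
  have hrank_lt : ∀ j < 2 ^ T, ∀ i ≤ 2 ^ T, j < i → rank (y j) (x i) = k.succ := by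
    intro j hj i hi hji
    refine Fin.ext (rank_eq (hym j hj) (by simp) fun l => ?_)
    rw [Fin.lt_def, hyval j hj, hxval i hi, Fin.val_succ]
    unfold slidingPoint
    split_ifs <;> omega
  have hrank_ge : ∀ j < 2 ^ T, ∀ i ≤ 2 ^ T, i ≤ j → rank (y j) (x i) = k.castSucc := by
    intro j hj i hi hji
    refine Fin.ext (rank_eq (hym j hj) (by simp) fun l => ?_)
    rw [Fin.lt_def, hyval j hj, hxval i hi, Fin.val_castSucc]
    unfold slidingPoint
    split_ifs <;> omega
  let S : ℕ → Sample X m := fun j t => (w (y j (g t).1), (g t).2)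
  obtain ⟨t₀, ht₀⟩ : ∃ t, (g t).1 = k := (Finite.injective_iff_surjective.1 hg) k
  have hnb : ∀ j < 2 ^ T, 0 < j → Neighbors (S j) (S 0) := by
    intro j hj hj0
    refine ⟨t₀, fun h => ?_, fun t ht => ?_⟩
    · have h1 := congrArg Fin.val (w.injective (congrArg Prod.fst h))
      rw [hyval j hj, hyval 0 (by positivity), ht₀] at h1
      simp [slidingPoint] at h1
      omega
    · have hne : (g t).1 ≠ k := fun h => ht (hg (h.trans ht₀.symm))
      have hne' : ((g t).1 : ℕ) ≠ k := fun h => hne (Fin.ext h)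
      simp [S, y, slidingPoint, hne']
  let := A.events
  have hδ : 0 ≤ δ := (hA _ _ (hnb 1 (Nat.one_lt_two_pow hT0.ne') one_pos)).delta_nonneg
  refine two_pow_le_of_indistinguishable (r := (v k.succ + v k.castSucc) / 2) (χ := χ)
    (fun j => A.out (S j)) (fun j _ => A.isProbabilityMeasure_out _) (fun j hj => ?_)
    (fun i => {h | h (w (x i)) = true}) (fun i _ => A.measurableSet_apply_eq _ _) hχ
    (fun j hj i hi hji => ?_) (fun j hj i hi hji => ?_) hTδ hT
  · rcases Nat.eq_zero_or_pos j with rfl | hj0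
    · exact Indistinguishable.refl hε hδ _
    · exact hA _ _ (hnb j hj hj0)
  · have h := abs_le.1 (hv (y j) (hym j hj) (x i) (hyx j hj i hi))
    rw [hrank_lt j hj i hi hji] at h
    change _ ≤ A.prob (S j) (w (x i))
    simp only [S]
    linarith [h.1]
  · have h := abs_le.1 (hv (y j) (hym j hj) (x i) (hyx j hj i hi))
    rw [hrank_ge j hj i hi hji] at h
    change A.prob (S j) (w (x i)) ≤ _
    simp only [S]
    linarith [h.2]

/-! ### Lower bounds on the sample complexity -/

/-- One example does not suffice to learn thresholds on two points, even without privacy: an example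
at the larger point with label `+1` says nothing about the label of the smaller point. -/
theorem LearningAlgorithm.Accurate.card_le_one {X : Set ℝ} {m : ℕ} {A : LearningAlgorithm X m}
    (hA : A.Accurate (1 / 16) (1 / 16) (thresholds X)) (hm : m ≤ 1) (V : Finset X) :
    V.card ≤ 1 := by
  classical
  by_contra! hV
  obtain ⟨W, -, hW⟩ := Finset.exists_subset_card_eq (show 2 ≤ V.card from hV)
  let w : Fin 2 ↪o X := W.orderEmbOfFin hW
  let S : Sample X m := fun _ => (w 1, true)
  have := A.isProbabilityMeasure_out S
  have key : ∀ K : ℕ, K < 2 →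
      @Measure.real _ A.events (A.out S) {h | h (w 0) = !decide (K ≤ 0)} ≤ 1 / 7 := by
    intro K hK
    let := A.events
    obtain ⟨u, hu, h⟩ := hA.exists_sample w hK {fun _ => 1} (by
      rw [Finset.card_singleton]
      calc 2 ^ m ≤ 2 ^ 1 := Nat.pow_le_pow_right (by norm_num) hm
        _ = _ := by norm_num)
    rw [Finset.mem_singleton] at hu
    subst hu
    have hlab : decide (K ≤ ((1 : Fin 2) : ℕ)) = true := decide_eq_true (by simp; omega)
    simp only [hlab] at h
    refine le_trans (measureReal_mono fun f hf => ?_) h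
    change f (w 0) = !decide (K ≤ 0) at hf
    change 1 / 16 < loss (labelledUniform w K) f
    rw [loss_labelledUniform]
    have h1 : 1 ≤ (Finset.univ.filter fun i : Fin 2 => f (w i) ≠ decide (K ≤ (i : ℕ))).card :=
      Finset.card_pos.2 ⟨0, Finset.mem_filter.2 ⟨Finset.mem_univ _, by simp [hf]⟩⟩
    have h2 : (1 : ℝ) ≤ (Finset.univ.filter fun i : Fin 2 =>
      f (w i) ≠ decide (K ≤ (i : ℕ))).card := by exact_mod_cast h1
    push_cast
    linarith
  have h0 := key 0 (by norm_num)
  have h1 := key 1 (by norm_num)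
  simp only [le_refl, decide_true, Bool.not_true] at h0
  simp only [Nat.le_zero, one_ne_zero, decide_false, Bool.not_false] at h1
  rw [A.measureReal_apply_eq_false] at h0
  change A.prob S (w 0) ≤ _ at h1
  linarith

theorem sq_le_two_pow {x : ℕ} (hx : 4 ≤ x) : x ^ 2 ≤ 2 ^ x := by
  induction x, hx using Nat.le_induction with
  | base => norm_num
  | succ x hx ih => rw [pow_succ 2]; nlinarith

theorem two_pow_two_pow_two_pow_le_tower (x : ℕ) : 2 ^ 2 ^ 2 ^ x ≤ tower (x + 3) :=
  Nat.pow_le_pow_right (by norm_num) (Nat.pow_le_pow_right (by norm_num)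
    (Nat.pow_le_pow_right (by norm_num) (lt_tower x).le))

/-- The number of colours of the Ramsey argument. -/
theorem card_colours_le_tower (m : ℕ) (hm : 1 ≤ m) :
    ((100 * m + 1) ^ (m + 1)) ^ (m * 2) ^ m ≤ tower (m + 14) := by
  refine le_trans ?_ (two_pow_two_pow_two_pow_le_tower (m + 11))
  have h1 : 100 * m + 1 ≤ 2 ^ (100 * m) := Nat.lt_two_pow_self
  have hmm : m ≤ 2 ^ m := Nat.lt_two_pow_self.le
  have h2 : (m * 2) ^ m ≤ 2 ^ ((m + 1) * m) := by
    rw [pow_mul, pow_succ]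
    exact Nat.pow_le_pow_left (Nat.mul_le_mul_right _ hmm) _
  have h3 : 100 * m * (m + 1) ≤ 2 ^ (m + m + 8) := by
    rw [pow_add, pow_add]
    nlinarith [Nat.mul_le_mul hmm hmm]
  calc _ ≤ ((2 ^ (100 * m)) ^ (m + 1)) ^ (m * 2) ^ m :=
        Nat.pow_le_pow_left (Nat.pow_le_pow_left h1 _) _
    _ = 2 ^ (100 * m * (m + 1) * (m * 2) ^ m) := by rw [← pow_mul, ← pow_mul, mul_assoc (100 * m)]
    _ ≤ 2 ^ 2 ^ 2 ^ (m + 11) := by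
        refine Nat.pow_le_pow_right (by norm_num) ((Nat.mul_le_mul h3 h2).trans ?_)
        rw [← pow_add]
        refine Nat.pow_le_pow_right (by norm_num)
          (le_trans ?_ (sq_le_two_pow (x := m + 11) (by omega)))
        nlinarith

/-- The size of the homogeneous set. -/
theorem card_homogeneous_le_tower {m ℓ : ℕ} (hℓ : ℓ ≤ m) :
    2 * 2 ^ (4000 * m ^ 2 * ℓ + 1) ≤ tower (m + 14) := by
  refine le_trans ?_ (two_pow_two_pow_two_pow_le_tower (m + 11))
  rw [← pow_succ']
  refine Nat.pow_le_pow_right (by norm_num) ?_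
  have hmm : m ≤ 2 ^ m := Nat.lt_two_pow_self.le
  have h1 : m ^ 2 * ℓ ≤ 2 ^ (3 * m) := by
    calc m ^ 2 * ℓ ≤ m ^ 2 * m := Nat.mul_le_mul_left _ hℓ
      _ = m ^ 3 := by ring
      _ ≤ (2 ^ m) ^ 3 := Nat.pow_le_pow_left hmm 3
      _ = 2 ^ (3 * m) := by rw [← pow_mul, mul_comm]
  calc 4000 * m ^ 2 * ℓ + 1 + 1 ≤ 2 ^ (3 * m) * 2 ^ 13 := by
        have : 1 ≤ 2 ^ (3 * m) := Nat.one_le_two_pow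
        nlinarith
    _ = 2 ^ (3 * m + 13) := (pow_add _ _ _).symm
    _ ≤ 2 ^ 2 ^ (m + 11) := Nat.pow_le_pow_right (by norm_num)
        (le_trans (by omega) (three_mul_le_two_pow (x := m + 11) (by omega)))

theorem three_mul_exp_lt_two_pow {T : ℕ} (hT : 6 < T) : 3 * Real.exp (T * 0.1) < 2 ^ T := by
  have h1 : Real.exp 0.1 ≤ 3 / 2 := by
    refine le_of_pow_le_pow_left₀ (n := 10) (by norm_num) (by norm_num) ?_
    rw [← Real.exp_nat_mul]
    norm_num
    linarith [Real.exp_one_lt_d9]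
  have h2 := one_add_mul_le_pow (a := (1 / 3 : ℝ)) (by norm_num) T
  have hT' : (6 : ℝ) < T := by exact_mod_cast hT
  have h3 : Real.exp (T * 0.1) ≤ (3 / 2) ^ T := by
    rw [Real.exp_nat_mul]
    exact pow_le_pow_left₀ (Real.exp_pos _).le h1 T
  have h4 : (2 : ℝ) ^ T = (3 / 2) ^ T * (1 + 1 / 3) ^ T := by
    rw [← mul_pow]; norm_num
  rw [h4]
  have h5 : (0 : ℝ) < (3 / 2) ^ T := by positivity
  nlinarith

/-- The union bound over the comparisons of the binary search. -/
theorem mul_exp_le_third {m ℓ : ℕ} (hm : 1 ≤ m) (hℓ : 1 ≤ ℓ) (hmℓ : m ≤ 2 ^ ℓ) :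
    ((4000 * m ^ 2 * ℓ : ℕ) : ℝ) *
      Real.exp (-2 * (6 / 100 / m) ^ 2 * (4000 * m ^ 2 * ℓ : ℕ)) ≤ 1 / 3 := by
  have hm0 : (0 : ℝ) < m := by exact_mod_cast hm
  have h1 : -2 * (6 / 100 / m : ℝ) ^ 2 * (4000 * m ^ 2 * ℓ : ℕ) = ℓ * (-28.8) := by
    push_cast
    field_simp
    norm_num
  have h2 : Real.exp (-28.8) ≤ (1 / 2) ^ 28 := by
    calc Real.exp (-28.8) ≤ Real.exp ((28 : ℕ) * (-1)) := Real.exp_le_exp.2 (by norm_num)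
      _ = Real.exp (-1) ^ 28 := Real.exp_nat_mul _ _
      _ ≤ (1 / 2) ^ 28 := by
        refine pow_le_pow_left₀ (Real.exp_pos _).le ?_ _
        rw [Real.exp_neg, one_div]
        exact inv_anti₀ (by norm_num) (by linarith [Real.add_one_le_exp (1 : ℝ)])
  have h3 : 4000 * m ^ 2 * ℓ * 3 ≤ 2 ^ (28 * ℓ) := by
    calc 4000 * m ^ 2 * ℓ * 3 ≤ 4000 * (2 ^ ℓ) ^ 2 * 2 ^ ℓ * 3 := by
          gcongr
          exact Nat.lt_two_pow_self.le
      _ = 12000 * 2 ^ (3 * ℓ) := by ring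
      _ ≤ 2 ^ (14 * ℓ) * 2 ^ (3 * ℓ) := by
          gcongr
          calc 12000 ≤ 2 ^ 14 := by norm_num
            _ ≤ 2 ^ (14 * ℓ) := Nat.pow_le_pow_right (by norm_num) (by omega)
      _ ≤ _ := by
          rw [← pow_add]
          exact Nat.pow_le_pow_right (by norm_num) (by omega)
  have h4 : ((4000 * m ^ 2 * ℓ : ℕ) : ℝ) * 3 ≤ 2 ^ (28 * ℓ) := by exact_mod_cast h3
  rw [h1, Real.exp_nat_mul]
  calc _ ≤ ((4000 * m ^ 2 * ℓ : ℕ) : ℝ) * ((1 / 2) ^ 28) ^ ℓ := by gcongr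
    _ = ((4000 * m ^ 2 * ℓ : ℕ) : ℝ) / 2 ^ (28 * ℓ) := by
        rw [← pow_mul, one_div, inv_pow, div_eq_mul_inv]
    _ ≤ 1 / 3 := by
        rw [div_le_iff₀ (by positivity)]
        linarith

theorem mul_delta_le_third {m : ℕ} {δ : ℝ} (hm : 2 ≤ m)
    (hδ : δ * ((m : ℝ) ^ 2 * Real.logb 2 m) ≤ 1 / 24000) :
    ((4000 * m ^ 2 * (Nat.log 2 m + 1) : ℕ) : ℝ) * δ ≤ 1 / 3 := by
  rcases le_or_gt δ 0 with h0 | h0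
  · exact (mul_nonpos_of_nonneg_of_nonpos (by positivity) h0).trans (by norm_num)
  have h1 : ((Nat.log 2 m : ℕ) : ℝ) ≤ Real.logb 2 m := Real.natLog_le_logb m 2
  have h2 : (1 : ℝ) ≤ (Nat.log 2 m : ℕ) := by
    exact_mod_cast Nat.log_pos (by norm_num) hm
  push_cast
  calc 4000 * (m : ℝ) ^ 2 * ((Nat.log 2 m : ℕ) + 1) * δ
      ≤ 4000 * (m : ℝ) ^ 2 * (2 * Real.logb 2 m) * δ := by
        gcongr
        linarith
    _ = 8000 * (δ * ((m : ℝ) ^ 2 * Real.logb 2 m)) := by ring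
    _ ≤ 1 / 3 := by linarith

/-- The sizes of finite subsets of the domain of a private learner of thresholds are bounded in terms
of the sample complexity. -/
theorem card_le_tower {X : Set ℝ} {m : ℕ} {δ : ℝ} {A : LearningAlgorithm X m}
    (hacc : A.Accurate (1 / 16) (1 / 16) (thresholds X)) (hdp : A.DifferentiallyPrivate 0.1 δ)
    (hδ : δ * ((m : ℝ) ^ 2 * Real.logb 2 m) ≤ 1 / 24000) (V : Finset X) :
    V.card ≤ tower (13 * m) := by
  rcases Nat.lt_or_ge m 2 with hm | hm
  · exact (hacc.card_le_one (by omega) V).trans (tower_mono (Nat.zero_le _))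
  by_contra! hV
  -- `ℓ` is of order `log m`. The constant `4000` in `T` makes `exp (-2 * χ ^ 2 * T)` less than
  -- `2 ^ (-28 * ℓ)` for the margin `χ = 0.06 / m`, and hence less than `1 / (3 * T)`.
  set ℓ := Nat.log 2 m + 1 with hℓ
  have hℓm : ℓ ≤ m := Nat.log_lt_self 2 (by omega)
  have hmℓ : m ≤ 2 ^ ℓ := (Nat.lt_pow_succ_log_self (by norm_num) m).le
  set T := 4000 * m ^ 2 * ℓ with hT
  have hTm : 4000 * m ^ 2 ≤ T := Nat.le_mul_of_pos_right _ (by omega)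
  have hTK : T + 1 < 2 ^ (T + 1) := Nat.lt_two_pow_self
  have hm0 : (0 : ℝ) < m := by positivity
  obtain ⟨w, v, hv⟩ := exists_homogeneous_of_sample (m := m) (Q := 100 * m)
    (q := ((100 * m + 1) ^ (m + 1)) ^ (m * 2) ^ m) (N := 2 * 2 ^ (T + 1)) (by omega)
    (by
      rw [← pow_mul]
      refine le_trans ?_ (Nat.le_self_pow (by positivity) _)
      omega) le_rfl A.prob A.prob_mem_Icc (V := V) (by
      refine le_trans ?_ hV.le
      refine (ramseyBound_le_tower (by omega) (card_colours_le_tower m (by omega))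
        (card_homogeneous_le_tower hℓm) _).trans (tower_mono (by omega)))
  push_cast at hv
  obtain ⟨g, hg, k, hk⟩ := exists_jump hacc hm w (by nlinarith) (by nlinarith) v hv
  refine absurd (hdp.two_pow_le (χ := 6 / 100 / m) (by norm_num) (by nlinarith) w ?_ (v g)
    (by positivity) hg (hv g) k (le_trans (le_of_eq ?_) hk) (mul_delta_le_third hm hδ)
    (mul_exp_le_third (by omega) (by omega) hmℓ)) (not_le.2 (three_mul_exp_lt_two_pow ?_))
  · rw [pow_succ 2 T] at hTK ⊢
    nlinarith
  · field_simp
    norm_num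
  · nlinarith

theorem LearningAlgorithm.DifferentiallyPrivate.mono {X : Set ℝ} {m : ℕ} {ε ε' δ : ℝ}
    {A : LearningAlgorithm X m} (hA : A.DifferentiallyPrivate ε δ) (h : ε ≤ ε') :
    A.DifferentiallyPrivate ε' δ := by
  intro S S' hS E hE
  let := A.events
  have h1 := hA S S' hS E hE
  have h2 := Real.exp_le_exp.2 h
  constructor
  · refine h1.1.trans ?_
    gcongr
  · refine h1.2.trans ?_
    gcongr

end PrivateLearning

open PrivateLearning

theorem theorem1 :
    ∃ c₀ c : ℝ, 0 < c₀ ∧ 0 < c ∧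
      (∀ (X : Set ℝ) (n m : ℕ) (δ : ℝ) (A : LearningAlgorithm X m),
        X.Finite → X.ncard = n →
        A.Accurate (1 / 16) (1 / 16) (thresholds X) →
        A.DifferentiallyPrivate 0.1 δ →
        δ * ((m : ℝ) ^ 2 * Real.logb 2 m) ≤ c₀ →
        c * (logStar n : ℝ) ≤ m) ∧
      (∀ X : Set ℝ, X.Infinite →
        (∀ (m : ℕ) (δ : ℝ) (A : LearningAlgorithm X m),
          A.DifferentiallyPrivate 0.1 δ →
          δ * ((m : ℝ) ^ 2 * Real.logb 2 m) ≤ c₀ →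
          ¬ A.Accurate (1 / 16) (1 / 16) (thresholds X)) ∧
        ¬ PrivatelyLearnable (thresholds X)) := by
  refine ⟨1 / 24000, 1 / 13, by norm_num, by norm_num, ?_, fun X hX => ?_⟩
  · intro X n m δ A hX hn hacc hdp hδ
    have : Fintype X := hX.fintype
    have h := card_le_tower hacc hdp hδ Finset.univ
    rw [Finset.card_univ, ← Nat.card_eq_fintype_card, Nat.card_coe_set_eq, hn] at h
    have h1 : ((logStar n : ℕ) : ℝ) ≤ (13 * m : ℕ) := by
      exact_mod_cast logStar_le_of_le_tower (x := n) (by exact_mod_cast h)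
    push_cast at h1
    linarith
  · have hno : ∀ (m : ℕ) (δ : ℝ) (A : LearningAlgorithm X m),
        A.DifferentiallyPrivate 0.1 δ →
        δ * ((m : ℝ) ^ 2 * Real.logb 2 m) ≤ 1 / 24000 →
        ¬ A.Accurate (1 / 16) (1 / 16) (thresholds X) := by
      intro m δ A hdp hδ hacc
      have := hX.to_subtype
      obtain ⟨V, hV⟩ := Infinite.exists_subset_card_eq X (tower (13 * m) + 1)
      have h := card_le_tower hacc hdp hδ V
      omega
    refine ⟨hno, ?_⟩
    rintro ⟨A, ε, δ, hdp, hε, hδ, hacc⟩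
    obtain ⟨m₀, hm₀⟩ := hacc (1 / 16) (1 / 16) (by norm_num) (by norm_num)
    obtain ⟨m, h1, h2, h3⟩ := ((hε 0.1 (by norm_num)).and
      ((hδ 4).and (Filter.eventually_ge_atTop (max m₀ 24000)))).exists
    refine hno m (δ m) (A m) ((hdp m).mono h1) ?_ (hm₀ m ((le_max_left _ _).trans h3))
    have hm : (24000 : ℝ) ≤ m := by exact_mod_cast (le_max_right _ _).trans h3
    have hlog0 : 0 ≤ Real.logb 2 m := Real.logb_nonneg (by norm_num) (by linarith)
    have hlog : Real.logb 2 m ≤ m := by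
      rw [Real.logb_le_iff_le_rpow (by norm_num) (by linarith), Real.rpow_natCast]
      exact_mod_cast Nat.lt_two_pow_self.le
    calc δ m * ((m : ℝ) ^ 2 * Real.logb 2 m)
        ≤ 1 / (m : ℝ) ^ 4 * ((m : ℝ) ^ 2 * m) := by gcongr
      _ = 1 / (m : ℝ) := by field_simp
      _ ≤ 1 / 24000 := one_div_le_one_div_of_le (by norm_num) hm
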